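/- Let $M$ be a finite-dimensional smooth manifold with a Finsler structure $F:TM\to[0,\infty)$: $F$ is positive and $C^\infty$ on $TM\setminus\{0\}$, satisfies $F(x,\lambda y)=\lambda F(x,y)$ for all $\lambda>0$, and the matrix $g_{ij}(x,y)=\frac12\frac{\partial^2F^2}{\partial y^i\partial y^j}(x,y)$ is positive definite for all $y\neq0$ (the symmetry $F(x,-y)=F(x,y)$ is not required). Let $d(p,q)=\inf_\sigma\int_a^bF(\sigma(t),\dot\sigma(t))\,dt$, the infimum being over all piecewise $C^\infty$ curves $\sigma:[a,b]\to M$ from $p$ to $q$ (with $d(p,q)=\infty$ if there are none); in general $d$ is not symmetric. Let $\gamma:[0,1]\to M$ be a Lipschitz curve, that is, there is $K\ge 0$ with $d(\gamma(s),\gamma(t))\le K|s-t|$ for all $s,t\in[0,1]$. Then $\gamma$ is differentiable at almost every $t\in[0,1]$, the function $t\mapsto F(\gamma(t),\dot\gamma(t))$ is integrable on $[0,1]$, and $$l(\gamma)=L(\gamma),$$ where $$l(\gamma)=\sup\Big\{\sum_{i=1}^kd(\gamma(t_{i-1}),\gamma(t_i))\ \Big|\ 0=t_0<t_1<\dots<t_k=1\Big\},\qquad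 L(\gamma)=\int_0^1F(\gamma(t),\dot\gamma(t))\,dt.$$ -/

import Mathlib

open Set MeasureTheory
open scoped Manifold ContDiff ENNReal NNReal

/-- The fundamental tensor `g_{(x,y)}(u, v) = ∑ g_{ij}(x,y) u^i v^j`, where
`g_{ij} = (1/2) ∂²F²/∂y^i∂y^j`: half of the second derivative at `y` of the restriction of `F²`
to the tangent space at `x` (a copy of the model space `E`). -/
noncomputable def finslerFundamentalTensor
    {E : Type*} [NormedAddCommGroup E] [NormedSpace ℝ E]
    {M : Type*} [TopologicalSpace M] [ChartedSpace E M]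
    (F : TangentBundle 𝓘(ℝ, E) M → ℝ) (x : M) (y u v : E) : ℝ :=
  (1 / 2 : ℝ) * fderiv ℝ (fderiv ℝ (fun z : E ↦ F ⟨x, z⟩ ^ 2)) y u v

/-- A Finsler structure on a smooth manifold `M`: a function `F : TM → [0, ∞)` that is positive and
smooth off the zero section, positively homogeneous of degree one on each tangent space, and has
positive definite fundamental tensor at every nonzero tangent vector. No symmetry
`F (-y) = F y` is required. -/
structure FinslerStructure
    (E : Type*) [NormedAddCommGroup E] [NormedSpace ℝ E]
    (M : Type*) [TopologicalSpace M] [ChartedSpace E M] [IsManifold 𝓘(ℝ, E) ∞ M] where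
  /-- The Finsler function on the tangent bundle. -/
  toFun : TangentBundle 𝓘(ℝ, E) M → ℝ
  nonneg : ∀ w, 0 ≤ toFun w
  pos : ∀ w : TangentBundle 𝓘(ℝ, E) M, w.2 ≠ 0 → 0 < toFun w
  smooth : ContMDiffOn (𝓘(ℝ, E).tangent) 𝓘(ℝ, ℝ) ∞ toFun
    {w : TangentBundle 𝓘(ℝ, E) M | w.2 ≠ 0}
  homogeneous : ∀ (x : M) (y : TangentSpace 𝓘(ℝ, E) x) (c : ℝ), 0 < c →
    toFun ⟨x, c • y⟩ = c * toFun ⟨x, y⟩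
  posDef : ∀ (x : M) (y v : E), y ≠ 0 → v ≠ 0 → 0 < finslerFundamentalTensor toFun x y v v

/-- `IsPartition a b k t` : `a = t 0 < t 1 < ⋯ < t k = b` (the values `t i` for `i > k` play no
role). -/
def IsPartition (a b : ℝ) (k : ℕ) (t : ℕ → ℝ) : Prop :=
  t 0 = a ∧ t k = b ∧ ∀ i < k, t i < t (i + 1)

/-- The curve `γ : [a, b] → M` is piecewise `C^∞`. Continuity on `[a, b]` is implied, since the
pieces are closed intervals. -/
def IsPiecewiseSmoothCurve
    (E : Type*) [NormedAddCommGroup E] [NormedSpace ℝ E]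
    {M : Type*} [TopologicalSpace M] [ChartedSpace E M]
    (a b : ℝ) (γ : ℝ → M) : Prop :=
  ∃ (k : ℕ) (t : ℕ → ℝ), IsPartition a b k t ∧
    ∀ i < k, ContMDiffOn 𝓘(ℝ, ℝ) 𝓘(ℝ, E) ∞ γ (Icc (t i) (t (i + 1)))

namespace FinslerStructure

variable {E : Type*} [NormedAddCommGroup E] [NormedSpace ℝ E]
  {M : Type*} [TopologicalSpace M] [ChartedSpace E M] [IsManifold 𝓘(ℝ, E) ∞ M]

/-- The speed `F(γ(t), γ'(t))` of a curve `γ : [a, b] → M`, meaningful where `γ` is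
differentiable. It depends only on the restriction of `γ` to `[a, b]`, if `t ∈ [a, b]`. -/
noncomputable def speed (F : FinslerStructure E M) (a b : ℝ) (γ : ℝ → M) (t : ℝ) : ℝ :=
  F.toFun ⟨γ t, mfderivWithin 𝓘(ℝ, ℝ) 𝓘(ℝ, E) γ (Icc a b) t (1 : ℝ)⟩

/-- The integral length `L(γ) = ∫_a^b F(γ(t), γ'(t)) dt` of a curve `γ : [a, b] → M` that is
differentiable almost everywhere. -/
noncomputable def integralLength (F : FinslerStructure E M) (a b : ℝ) (γ : ℝ → M) : ℝ≥0∞ :=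
  ∫⁻ t in Icc a b, ENNReal.ofReal (F.speed a b γ t)

/-- The (in general non-symmetric) Finslerian distance: the infimum of the integral lengths of the
piecewise smooth curves from `p` to `q`. It is `∞` if there are none, that is, if `p` and `q` lie
in different components. -/
noncomputable def dist (F : FinslerStructure E M) (p q : M) : ℝ≥0∞ :=
  ⨅ (a : ℝ) (b : ℝ) (γ : ℝ → M) (_ : IsPiecewiseSmoothCurve E a b γ ∧ γ a = p ∧ γ b = q),
    F.integralLength a b γ

/-- The metric length `l(γ)` of `γ : [a, b] → M`: the supremum of
`∑ d(γ(t_{i-1}), γ(t_i))` over all partitions of `[a, b]`. -/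
noncomputable def metricLength (F : FinslerStructure E M) (a b : ℝ) (γ : ℝ → M) : ℝ≥0∞ :=
  ⨆ (k : ℕ) (t : ℕ → ℝ) (_ : IsPartition a b k t),
    ∑ i ∈ Finset.range k, F.dist (γ (t i)) (γ (t (i + 1)))

/-- `γ : [a, b] → M` is Lipschitz with respect to the Finslerian distance. -/
def IsLipschitzCurve (F : FinslerStructure E M) (a b : ℝ) (γ : ℝ → M) : Prop :=
  ∃ K : ℝ≥0, ∀ s ∈ Icc a b, ∀ t ∈ Icc a b,
    F.dist (γ s) (γ t) ≤ K * ENNReal.ofReal |s - t|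

end FinslerStructure

/-! The heart of the matter is that the speed is the metric derivative: where `γ` is differentiable,
`d(γ(a), γ(b)) / (b - a)` tends to `F(γ(t), γ'(t))` as intervals with `a ≤ t ≤ b` shrink to `t`
(`tendsto_dist_div`). The upper bound comes from coordinate segments, the lower one from convexity.
Positive definiteness of `g` gives each `F(x, ·)` a supporting linear functional `l` at every vector
(`exists_support`). Near the base point `(1 - ε) l` is still dominated by `F`, so integrating it
along a competing curve bounds the length of that curve below, unless the curve leaves a coordinate
ball, which costs a fixed amount (`mem_ball_or_le_integralLength`).

The same estimate with norming functionals shows that a Lipschitz curve is Lipschitz in coordinates,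
hence differentiable almost everywhere. A sum of distances over a uniform grid is the integral of a
step function of difference quotients, bounded by the Lipschitz constant `K`, so dominated
convergence makes these sums tend to the integral of the speed (`tendsto_sum_dist`). As the sums are
partition sums, `L ≤ l`; as each dominates the distance of the end points by the triangle
inequality, `d(γ(a), γ(b))` is at most the integral of the speed over `(a, b)`, and adding over a
partition gives `l ≤ L`. -/

open Filter Topology

/-! ### The fundamental inequality for the square of a Minkowski norm. -/

/-- A function on a normed space that is positively homogeneous of degree two and `C²` with
nonnegative second derivative off the origin satisfies the fundamental inequality. -/
lemma fderiv_le_add_of_homogeneous_two {E : Type*} [NormedAddCommGroup E] [NormedSpace ℝ E]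
    {Φ : E → ℝ} (hΦ : ContDiffOn ℝ 2 Φ {0}ᶜ) (hnn : ∀ z, 0 ≤ Φ z)
    (hhom : ∀ (c : ℝ) (z : E), 0 < c → Φ (c • z) = c ^ 2 * Φ z)
    (hpos : ∀ y v : E, y ≠ 0 → v ≠ 0 → 0 < fderiv ℝ (fderiv ℝ Φ) y v v)
    {y : E} (hy : y ≠ 0) (w : E) :
    fderiv ℝ Φ y y = 2 * Φ y ∧ fderiv ℝ Φ y w ≤ Φ w + Φ y := by
  have hd : ∀ z : E, z ≠ 0 → HasFDerivAt Φ (fderiv ℝ Φ z) z := fun z hz ↦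
    ((hΦ.contDiffAt (isOpen_compl_singleton.mem_nhds hz)).differentiableAt (by norm_num)).hasFDerivAt
  have hd2 : ∀ z : E, z ≠ 0 → HasFDerivAt (fderiv ℝ Φ) (fderiv ℝ (fderiv ℝ Φ) z) z := fun z hz ↦
    (((hΦ.contDiffAt (isOpen_compl_singleton.mem_nhds hz)).fderiv_right (m := 1)
      (by norm_num)).differentiableAt (by norm_num)).hasFDerivAt
  have euler : fderiv ℝ Φ y y = 2 * Φ y := by
    have h1 : HasDerivAt (fun c : ℝ ↦ c • y) y 1 := by
      simpa using (hasDerivAt_id (1 : ℝ)).smul_const y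
    have h2 : HasDerivAt (fun c : ℝ ↦ Φ (c • y)) (fderiv ℝ Φ y y) 1 := by
      have := hd y hy
      rw [← one_smul ℝ y] at this
      have h3 := this.comp_hasDerivAt (1 : ℝ) h1
      simpa [Function.comp_def] using h3
    have h3 : HasDerivAt (fun c : ℝ ↦ c ^ 2 * Φ y) (2 * Φ y) 1 := by
      simpa using (hasDerivAt_pow 2 (1 : ℝ)).mul_const (Φ y)
    refine h2.unique (h3.congr_of_eventuallyEq ?_)
    filter_upwards [lt_mem_nhds (zero_lt_one (α := ℝ))] with c hc using hhom c y hc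
  refine ⟨euler, ?_⟩
  -- `Φ` need not be `C²` at the origin. If the segment from `y` to `w` meets it, `w` is a
  -- nonpositive multiple of `y` and Euler's identity makes the left side nonpositive.
  by_cases hseg : ∃ t ∈ Icc (0 : ℝ) 1, y + t • (w - y) = 0
  · obtain ⟨t, ⟨ht0, ht1⟩, ht⟩ := hseg
    have ht0' : 0 < t := by
      rcases ht0.eq_or_lt with h | h
      · exact absurd (by simpa [← h] using ht) hy
      · exact h
    have hw : w = (-((1 - t) / t)) • y := by
      have : t • w = (-(1 - t)) • y := by
        have h : t • w - (-(1 - t)) • y = y + t • (w - y) := by module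
        rw [ht] at h
        exact sub_eq_zero.1 h
      calc w = t⁻¹ • t • w := by rw [smul_smul, inv_mul_cancel₀ ht0'.ne', one_smul]
        _ = _ := by rw [this, smul_smul]; congr 1; field_simp
    rw [hw, map_smul, euler, smul_eq_mul, ← hw]
    have : 0 ≤ (1 - t) / t := div_nonneg (by linarith) ht0
    nlinarith [hnn w, hnn y, mul_nonneg this (hnn y)]
  · push Not at hseg
    rcases eq_or_ne w y with rfl | hwy
    · linarith [euler]
    have hline : ∀ t : ℝ, HasDerivAt (fun t : ℝ ↦ y + t • (w - y)) (w - y) t := fun t ↦ by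
      simpa using ((hasDerivAt_id t).smul_const (w - y)).const_add y
    have h1 : ∀ t ∈ Icc (0 : ℝ) 1, HasDerivAt (fun t : ℝ ↦ Φ (y + t • (w - y)))
        (fderiv ℝ Φ (y + t • (w - y)) (w - y)) t := fun t ht ↦
      (hd _ (hseg t ht)).comp_hasDerivAt t (hline t)
    have h2 : ∀ t ∈ Icc (0 : ℝ) 1,
        HasDerivAt (fun t : ℝ ↦ fderiv ℝ Φ (y + t • (w - y)) (w - y))
        (fderiv ℝ (fderiv ℝ Φ) (y + t • (w - y)) (w - y) (w - y)) t := fun t ht ↦ by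
      have := (hd2 _ (hseg t ht)).comp_hasDerivAt t (hline t)
      exact this.clm_apply (hasDerivAt_const t (w - y)) |>.congr_deriv (by simp)
    have hint : interior (Icc (0 : ℝ) 1) ⊆ Icc 0 1 := interior_subset
    have hconv : ConvexOn ℝ (Icc (0 : ℝ) 1) (fun t : ℝ ↦ Φ (y + t • (w - y))) :=
      convexOn_of_hasDerivWithinAt2_nonneg (convex_Icc 0 1)
        (fun t ht ↦ (h1 t ht).continuousAt.continuousWithinAt)
        (fun t ht ↦ (h1 t (hint ht)).hasDerivWithinAt)
        (fun t ht ↦ (h2 t (hint ht)).hasDerivWithinAt)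
        (fun t ht ↦ (hpos _ _ (hseg t (hint ht)) (sub_ne_zero.2 hwy)).le)
    have h0 : (0 : ℝ) ∈ Icc (0 : ℝ) 1 := by simp
    -- The tangent at `y` lies below the graph: `dΦ_y(w - y) ≤ Φ w - Φ y`. Euler's identity turns
    -- this into the claim.
    have := hconv.le_slope_of_hasDerivWithinAt h0 (by simp : (1 : ℝ) ∈ Icc (0 : ℝ) 1) one_pos
      (h1 0 h0).hasDerivWithinAt
    simp only [slope, zero_smul, add_zero, sub_zero, inv_one, one_smul, vsub_eq_sub, map_sub,
      add_sub_cancel, euler] at this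
    linarith

/-! ### The Finsler function on a single tangent space. -/

namespace FinslerStructure

variable {E : Type*} [NormedAddCommGroup E] [NormedSpace ℝ E]
  {M : Type*} [TopologicalSpace M] [ChartedSpace E M] [IsManifold 𝓘(ℝ, E) ∞ M]

/-- The Finsler function as a function of a point and of a vector of the model space. -/
def fiberNorm (F : FinslerStructure E M) (x : M) (v : E) : ℝ := F.toFun ⟨x, v⟩

variable (F : FinslerStructure E M)

lemma fiberNorm_nonneg (x : M) (v : E) : 0 ≤ F.fiberNorm x v := F.nonneg _

lemma fiberNorm_pos (x : M) {v : E} (hv : v ≠ 0) : 0 < F.fiberNorm x v := F.pos ⟨x, v⟩ hv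

lemma fiberNorm_smul_of_pos (x : M) (v : E) {c : ℝ} (hc : 0 < c) :
    F.fiberNorm x (c • v) = c * F.fiberNorm x v := F.homogeneous x v c hc

lemma fiberNorm_zero (x : M) : F.fiberNorm x 0 = 0 := by
  have := F.fiberNorm_smul_of_pos x 0 (c := 2) two_pos
  rw [smul_zero] at this
  linarith

/-- In a trivialization the inclusion of a fibre is constant in the base and linear in the fibre. -/
lemma contMDiff_totalSpaceMk (x : M) :
    ContMDiff 𝓘(ℝ, E) (𝓘(ℝ, E).tangent) ∞
      (fun z : E ↦ (⟨x, z⟩ : TangentBundle 𝓘(ℝ, E) M)) := by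
  intro z
  rw [← contMDiffWithinAt_univ, Bundle.contMDiffWithinAt_totalSpace]
  refine ⟨contMDiffWithinAt_const, ContMDiff.contMDiffAt ?_⟩
  rw [contMDiff_iff_contDiff]
  have : IsManifold 𝓘(ℝ, E) 1 M := IsManifold.of_le (n := ∞) (by simp)
  simp only [TangentBundle.trivializationAt_apply]
  exact ContinuousLinearMap.contDiff _

lemma contDiffOn_fiberNorm (x : M) : ContDiffOn ℝ ∞ (F.fiberNorm x) {0}ᶜ := by
  rw [← contMDiffOn_iff_contDiffOn]
  exact F.smooth.comp (contMDiff_totalSpaceMk x).contMDiffOn (fun z hz ↦ hz)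

/-- The norm of each tangent space has a supporting linear functional at each vector. -/
lemma exists_support (x : M) (y : E) :
    ∃ l : E →L[ℝ] ℝ, l y = F.fiberNorm x y ∧ ∀ w, l w ≤ F.fiberNorm x w := by
  rcases eq_or_ne y 0 with rfl | hy
  · exact ⟨0, by simp [fiberNorm_zero], fun w ↦ F.fiberNorm_nonneg x w⟩
  set Φ : E → ℝ := fun z ↦ F.fiberNorm x z ^ 2 with hΦ
  have hy' := F.fiberNorm_pos x hy
  have key := fun w ↦ fderiv_le_add_of_homogeneous_two (Φ := Φ)
    (((F.contDiffOn_fiberNorm x).pow 2).of_le (WithTop.coe_le_coe.2 le_top)) (fun z ↦ sq_nonneg _)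
    (fun c z hc ↦ by simp only [hΦ, F.fiberNorm_smul_of_pos x z hc]; ring)
    (fun y v hy hv ↦ by
      have := F.posDef x y v hy hv
      unfold finslerFundamentalTensor at this
      exact (pos_iff_pos_of_mul_pos this).1 (by norm_num)) hy w
  -- Since `Φ = F²`, this functional is the differential of `F` at `y`.
  refine ⟨(2 * F.fiberNorm x y)⁻¹ • fderiv ℝ Φ y, ?_, fun w ↦ ?_⟩
  · rw [FunLike.coe_smul, Pi.smul_apply, (key y).1, smul_eq_mul]
    simp only [hΦ]
    field_simp
  · simp only [FunLike.coe_smul, Pi.smul_apply, smul_eq_mul]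
    rw [inv_mul_le_iff₀ (by positivity)]
    rcases eq_or_ne w 0 with rfl | hw
    · simp [fiberNorm_zero]
    have hw' := F.fiberNorm_pos x hw
    have hc : 0 < F.fiberNorm x y / F.fiberNorm x w := by positivity
    -- Rescaling `w` to the Finsler length of `y` makes the two terms on the right of the
    -- fundamental inequality equal, which is where the bound is sharp.
    have := (key ((F.fiberNorm x y / F.fiberNorm x w) • w)).2
    simp only [map_smul, hΦ, F.fiberNorm_smul_of_pos x w hc, smul_eq_mul] at this
    have h2 : F.fiberNorm x y / F.fiberNorm x w * F.fiberNorm x w = F.fiberNorm x y := by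
      field_simp
    rw [h2] at this
    rw [div_mul_eq_mul_div, div_le_iff₀ hw'] at this
    refine le_of_mul_le_mul_left (this.trans (le_of_eq ?_)) hy'
    ring

end FinslerStructure

/-! ### The Finsler function in a chart. -/

namespace FinslerStructure

variable {E : Type*} [NormedAddCommGroup E] [NormedSpace ℝ E]
  {M : Type*} [TopologicalSpace M] [ChartedSpace E M] [IsManifold 𝓘(ℝ, E) ∞ M]

/-- The derivative of the inverse of the chart at `p`, as a map between model spaces. -/
noncomputable def chartSymmDeriv (p : M) (x : E) : E →L[ℝ] E :=
  mfderiv 𝓘(ℝ, E) 𝓘(ℝ, E) (chartAt E p).symm x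

/-- The Finsler function read in the chart at `p`. -/
noncomputable def chartNorm (F : FinslerStructure E M) (p : M) (x v : E) : ℝ :=
  F.fiberNorm ((chartAt E p).symm x) (chartSymmDeriv p x v)

variable (F : FinslerStructure E M) (p : M)

lemma mdifferentiable_chartAt :
    (chartAt E p).MDifferentiable 𝓘(ℝ, E) 𝓘(ℝ, E) := by
  have : IsManifold 𝓘(ℝ, E) 1 M := IsManifold.of_le (n := ∞) (by simp)
  exact mdifferentiable_chart p

lemma chartNorm_nonneg (x v : E) : 0 ≤ F.chartNorm p x v := F.fiberNorm_nonneg _ _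

lemma chartNorm_zero (x : E) : F.chartNorm p x 0 = 0 := by
  unfold chartNorm
  rw [map_zero]
  exact F.fiberNorm_zero _

lemma chartNorm_smul_of_pos (x v : E) {c : ℝ} (hc : 0 < c) :
    F.chartNorm p x (c • v) = c * F.chartNorm p x v := by
  unfold chartNorm
  rw [map_smul]
  exact F.fiberNorm_smul_of_pos _ _ hc

lemma chartSymmDeriv_ne_zero {x v : E} (hx : x ∈ (chartAt E p).target) (hv : v ≠ 0) :
    chartSymmDeriv p x v ≠ 0 := by
  have h := (mdifferentiable_chartAt p).symm.mfderiv_injective (x := x) hx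
  intro h0
  exact hv (h (h0.trans (map_zero _).symm))

lemma chartNorm_pos {x v : E} (hx : x ∈ (chartAt E p).target) (hv : v ≠ 0) :
    0 < F.chartNorm p x v := F.fiberNorm_pos _ (chartSymmDeriv_ne_zero p hx hv)

/-- The tangent map of the inverse chart is continuous and injective on fibres, so it avoids the
zero section, off which `F` is smooth. -/
lemma continuousOn_chartNorm :
    ContinuousOn (fun z : E × E ↦ F.chartNorm p z.1 z.2) ((chartAt E p).target ×ˢ {0}ᶜ) := by
  have : IsManifold 𝓘(ℝ, E) 1 M := IsManifold.of_le (n := ∞) (by simp)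
  have h1 : ContMDiffOn 𝓘(ℝ, E) 𝓘(ℝ, E) 1 (chartAt E p).symm (chartAt E p).target :=
    contMDiffOn_chart_symm
  have h2 := h1.continuousOn_tangentMapWithin le_rfl
    (chartAt E p).open_target.uniqueMDiffOn
  have h3 : Continuous fun z : E × E ↦ (⟨z.1, z.2⟩ : TangentBundle 𝓘(ℝ, E) E) :=
    (tangentBundleModelSpaceHomeomorph 𝓘(ℝ, E)).symm.continuous
  have h4 : ContinuousOn (fun z : E × E ↦ tangentMapWithin 𝓘(ℝ, E) 𝓘(ℝ, E) (chartAt E p).symm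
      (chartAt E p).target ⟨z.1, z.2⟩) ((chartAt E p).target ×ˢ {0}ᶜ) :=
    h2.comp h3.continuousOn (fun z hz ↦ hz.1)
  have h5 : ∀ z ∈ (chartAt E p).target ×ˢ ({0}ᶜ : Set E),
      tangentMapWithin 𝓘(ℝ, E) 𝓘(ℝ, E) (chartAt E p).symm (chartAt E p).target ⟨z.1, z.2⟩
      = (⟨(chartAt E p).symm z.1, mfderiv 𝓘(ℝ, E) 𝓘(ℝ, E) (chartAt E p).symm z.1 z.2⟩ :
        TangentBundle 𝓘(ℝ, E) M) := by
    intro z hz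
    simp only [tangentMapWithin]
    rw [mfderivWithin_of_mem_nhds ((chartAt E p).open_target.mem_nhds hz.1)]
  have h6 := h4.congr (fun z hz ↦ (h5 z hz).symm)
  exact F.smooth.continuousOn.comp h6 fun z hz ↦ by
    have h := chartSymmDeriv_ne_zero p hz.1 hz.2
    exact h

lemma exists_support_chartNorm (x y : E) :
    ∃ l : E →L[ℝ] ℝ, l y = F.chartNorm p x y ∧ ∀ w, l w ≤ F.chartNorm p x w := by
  obtain ⟨l, h1, h2⟩ := F.exists_support ((chartAt E p).symm x) (chartSymmDeriv p x y)
  exact ⟨l.comp (chartSymmDeriv p x), h1, fun w ↦ h2 _⟩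

/-- A bound on unit vectors extends to all vectors. -/
lemma chartNorm_abs_sub_le {x y : E} {ε : ℝ}
    (h : ∀ v ∈ Metric.sphere (0 : E) 1, |F.chartNorm p x v - F.chartNorm p y v| ≤ ε) (v : E) :
    |F.chartNorm p x v - F.chartNorm p y v| ≤ ε * ‖v‖ := by
  rcases eq_or_ne v 0 with rfl | hv
  · simp [chartNorm_zero]
  have hv' : 0 < ‖v‖ := norm_pos_iff.2 hv
  have h1 := h (‖v‖⁻¹ • v) (by simp [norm_smul, hv'.ne'])
  rw [F.chartNorm_smul_of_pos p _ _ (by positivity), F.chartNorm_smul_of_pos p _ _ (by positivity),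
    ← mul_sub, abs_mul, abs_of_pos (by positivity), inv_mul_le_iff₀ hv'] at h1
  linarith

variable [FiniteDimensional ℝ E]

/-- Compactness of the unit sphere makes joint continuity uniform in the direction; homogeneity then
scales the error with `‖v‖`. -/
lemma eventually_abs_chartNorm_sub_le {x₀ : E} (hx₀ : x₀ ∈ (chartAt E p).target) {ε : ℝ}
    (hε : 0 < ε) :
    ∀ᶠ x in 𝓝 x₀, ∀ v, |F.chartNorm p x v - F.chartNorm p x₀ v| ≤ ε * ‖v‖ := by
  have : ProperSpace E := FiniteDimensional.proper ℝ E
  have hK : IsCompact (Metric.sphere (0 : E) 1) := isCompact_sphere 0 1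
  have key : ∀ᶠ x in 𝓝 x₀, ∀ v ∈ Metric.sphere (0 : E) 1,
      |F.chartNorm p x v - F.chartNorm p x₀ v| ≤ ε := by
    refine hK.eventually_forall_of_forall_eventually fun v hv ↦ ?_
    have hv0 : v ≠ 0 := by rintro rfl; simp at hv
    have hmem : (chartAt E p).target ×ˢ ({0}ᶜ : Set E) ∈ 𝓝 (x₀, v) :=
      prod_mem_nhds ((chartAt E p).open_target.mem_nhds hx₀) (isOpen_compl_singleton.mem_nhds hv0)
    have hc : ContinuousAt (fun z : E × E ↦ F.chartNorm p z.1 z.2) (x₀, v) :=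
      (F.continuousOn_chartNorm p).continuousAt hmem
    have hc2 : ContinuousAt (fun z : E × E ↦ F.chartNorm p x₀ z.2) (x₀, v) :=
      ContinuousAt.comp (f := fun z : E × E ↦ (x₀, z.2))
        (g := fun z : E × E ↦ F.chartNorm p z.1 z.2) hc (by fun_prop)
    have hlim := (hc.sub hc2).abs
    have : ∀ᶠ z : E × E in 𝓝 (x₀, v), |F.chartNorm p z.1 z.2 - F.chartNorm p x₀ z.2| < ε :=
      hlim.tendsto.eventually_lt_const (by simpa using hε)
    filter_upwards [this] with z hz using hz.le
  filter_upwards [key] with x hx v using F.chartNorm_abs_sub_le p hx v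

lemma exists_mul_norm_le_chartNorm {x₀ : E} (hx₀ : x₀ ∈ (chartAt E p).target) :
    ∃ c > 0, ∀ v, c * ‖v‖ ≤ F.chartNorm p x₀ v := by
  have : ProperSpace E := FiniteDimensional.proper ℝ E
  have hK : IsCompact (Metric.sphere (0 : E) 1) := isCompact_sphere 0 1
  have hc : ContinuousOn (fun v : E ↦ F.chartNorm p x₀ v) (Metric.sphere (0 : E) 1) :=
    (F.continuousOn_chartNorm p).comp (f := fun v : E ↦ (x₀, v)) (by fun_prop)
      (fun v hv ↦ ⟨hx₀, by rintro rfl; simp at hv⟩)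
  obtain ⟨c, hc0, hc⟩ := hK.exists_forall_le' hc (a := 0)
    (fun v hv ↦ F.chartNorm_pos p hx₀ (by rintro rfl; simp at hv))
  refine ⟨c, hc0, fun v ↦ ?_⟩
  rcases eq_or_ne v 0 with rfl | hv
  · simp [chartNorm_zero]
  have hv' : 0 < ‖v‖ := norm_pos_iff.2 hv
  have h1 := hc (‖v‖⁻¹ • v) (by simp [norm_smul, hv'.ne'])
  rw [F.chartNorm_smul_of_pos p _ _ (by positivity), le_inv_mul_iff₀ hv'] at h1
  linarith

/-- Only the origin is at issue: there a bound on the unit sphere and homogeneity give `F ≤ C‖v‖`.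
-/
lemma continuous_chartNorm {x₀ : E} (hx₀ : x₀ ∈ (chartAt E p).target) :
    Continuous (F.chartNorm p x₀) := by
  have : ProperSpace E := FiniteDimensional.proper ℝ E
  have hcn : ContinuousOn (F.chartNorm p x₀) {0}ᶜ :=
    (F.continuousOn_chartNorm p).comp (f := fun v : E ↦ (x₀, v)) (by fun_prop)
      (fun v hv ↦ ⟨hx₀, hv⟩)
  rw [continuous_iff_continuousAt]
  intro v
  rcases eq_or_ne v 0 with rfl | hv
  · obtain ⟨C, hC⟩ := (isCompact_sphere (0 : E) 1).exists_bound_of_continuousOn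
      (hcn.mono fun v hv ↦ by rintro rfl; simp at hv)
    have hb : ∀ v, F.chartNorm p x₀ v ≤ C * ‖v‖ := by
      intro v
      rcases eq_or_ne v 0 with rfl | hv
      · simp [chartNorm_zero]
      have hv' : 0 < ‖v‖ := norm_pos_iff.2 hv
      have h1 := (le_abs_self _).trans (hC (‖v‖⁻¹ • v) (by simp [norm_smul, hv'.ne']))
      rw [F.chartNorm_smul_of_pos p _ _ (by positivity), inv_mul_le_iff₀ hv'] at h1
      linarith
    rw [ContinuousAt, chartNorm_zero]
    refine squeeze_zero (F.chartNorm_nonneg p x₀) hb ?_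
    have : Continuous fun v : E ↦ C * ‖v‖ := by fun_prop
    simpa using this.tendsto 0
  · exact hcn.continuousAt (isOpen_compl_singleton.mem_nhds hv)

end FinslerStructure

/-! ### Derivatives of curves in charts. -/

section Curves

variable {E : Type*} [NormedAddCommGroup E] [NormedSpace ℝ E]
  {M : Type*} [TopologicalSpace M] [ChartedSpace E M] [IsManifold 𝓘(ℝ, E) ∞ M]
  (F : FinslerStructure E M) (p : M) {σ : ℝ → M} {s : Set ℝ} {t : ℝ}

lemma differentiableWithinAt_chartAt_comp (hσ : MDifferentiableWithinAt 𝓘(ℝ, ℝ) 𝓘(ℝ, E) σ s t)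
    (ht : σ t ∈ (chartAt E p).source) :
    DifferentiableWithinAt ℝ (fun u ↦ chartAt E p (σ u)) s t := by
  rw [← mdifferentiableWithinAt_iff_differentiableWithinAt]
  exact ((FinslerStructure.mdifferentiable_chartAt p).mdifferentiableAt
    ht).comp_mdifferentiableWithinAt t hσ

/-- Continuity is needed separately: the chart has arbitrary values off its source, so its composite
with `σ` recovers `σ` only where `σ` is known to stay in the source. -/
lemma hasMFDerivWithinAt_of_chartAt_comp {v : E} (hc : ContinuousWithinAt σ s t)
    (ht : σ t ∈ (chartAt E p).source)
    (hσ : HasDerivWithinAt (fun u ↦ chartAt E p (σ u)) v s t) :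
    HasMFDerivWithinAt 𝓘(ℝ, ℝ) 𝓘(ℝ, E) σ s t
      ((FinslerStructure.chartSymmDeriv p (chartAt E p (σ t))).comp
        (ContinuousLinearMap.toSpanSingleton ℝ v)) := by
  have h1 : HasMFDerivWithinAt 𝓘(ℝ, ℝ) 𝓘(ℝ, E) (fun u ↦ chartAt E p (σ u)) s t
      (ContinuousLinearMap.toSpanSingleton ℝ v) := hσ.hasFDerivWithinAt.hasMFDerivWithinAt
  have h2 := ((FinslerStructure.mdifferentiable_chartAt p).mdifferentiableAt_symm
    ((chartAt E p).map_source ht)).hasMFDerivAt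
  have h3 := h2.comp_hasMFDerivWithinAt t h1
  refine h3.congr_of_eventuallyEq ?_ ?_
  · filter_upwards [hc.eventually ((chartAt E p).open_source.mem_nhds ht)] with u hu
    exact ((chartAt E p).left_inv hu).symm
  · exact ((chartAt E p).left_inv ht).symm

lemma fiberNorm_mfderivWithin_eq_chartNorm {v : E} (hs : UniqueDiffWithinAt ℝ s t)
    (hc : ContinuousWithinAt σ s t) (ht : σ t ∈ (chartAt E p).source)
    (hσ : HasDerivWithinAt (fun u ↦ chartAt E p (σ u)) v s t) :
    F.fiberNorm (σ t) (mfderivWithin 𝓘(ℝ, ℝ) 𝓘(ℝ, E) σ s t (1 : ℝ))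
      = F.chartNorm p (chartAt E p (σ t)) v := by
  have h := (hasMFDerivWithinAt_of_chartAt_comp p hc ht hσ).mfderivWithin
    hs.uniqueMDiffWithinAt
  have h1 : (mfderivWithin 𝓘(ℝ, ℝ) 𝓘(ℝ, E) σ s t (1 : ℝ) : E)
      = FinslerStructure.chartSymmDeriv p (chartAt E p (σ t)) v := by
    rw [h]
    exact congrArg (FinslerStructure.chartSymmDeriv p (chartAt E p (σ t)))
      (one_smul ℝ v)
  unfold FinslerStructure.chartNorm
  rw [(chartAt E p).left_inv ht]
  exact congrArg (F.fiberNorm (σ t)) h1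

end Curves

/-! ### Partitions, piecewise smooth curves and concatenation. -/

lemma IsPartition.le_of_le {a b : ℝ} {k : ℕ} {t : ℕ → ℝ} (h : IsPartition a b k t) {i j : ℕ}
    (hij : i ≤ j) (hj : j ≤ k) : t i ≤ t j := by
  induction j, hij using Nat.le_induction with
  | base => exact le_rfl
  | succ n hn ih => exact (ih (by omega)).trans (h.2.2 n (by omega)).le

lemma IsPartition.mem_Icc {a b : ℝ} {k : ℕ} {t : ℕ → ℝ} (h : IsPartition a b k t) {i : ℕ}
    (hi : i ≤ k) : t i ∈ Icc a b :=
  ⟨h.1 ▸ h.le_of_le (Nat.zero_le i) hi, h.2.1 ▸ h.le_of_le hi le_rfl⟩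

section

variable {E : Type*} [NormedAddCommGroup E] [NormedSpace ℝ E]
  {M : Type*} [TopologicalSpace M] [ChartedSpace E M]

lemma IsPiecewiseSmoothCurve.le {a b : ℝ} {σ : ℝ → M} (h : IsPiecewiseSmoothCurve E a b σ) :
    a ≤ b := by
  obtain ⟨k, t, ht, -⟩ := h
  exact (ht.mem_Icc (Nat.zero_le k)).1.trans (ht.mem_Icc (Nat.zero_le k)).2

lemma IsPiecewiseSmoothCurve.continuousOn {a b : ℝ} {σ : ℝ → M}
    (h : IsPiecewiseSmoothCurve E a b σ) : ContinuousOn σ (Icc a b) := by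
  obtain ⟨k, t, ht, hs⟩ := h
  have key : ∀ i ≤ k, ContinuousOn σ (Icc a (t i)) := by
    intro i
    induction i with
    | zero => intro _; rw [ht.1, Icc_self]; exact continuousOn_singleton _ _
    | succ n ih =>
      intro hn
      rw [← Icc_union_Icc_eq_Icc (ht.mem_Icc (by omega : n ≤ k)).1 (ht.2.2 n (by omega)).le]
      exact (ih (by omega)).union_of_isClosed (hs n (by omega)).continuousOn isClosed_Icc
        isClosed_Icc
  exact ht.2.1 ▸ key k le_rfl

end

section

variable {M : Type*}

/-- Concatenation of two curves, the second one being translated. -/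
noncomputable def concatCurve (b c : ℝ) (σ τ : ℝ → M) (u : ℝ) : M :=
  if u ≤ b then σ u else τ (u + (c - b))

lemma concatCurve_of_le {b c : ℝ} {σ τ : ℝ → M} {u : ℝ} (h : u ≤ b) :
    concatCurve b c σ τ u = σ u := if_pos h

lemma concatCurve_of_ge {b c : ℝ} {σ τ : ℝ → M} {u : ℝ} (hq : σ b = τ c) (h : b ≤ u) :
    concatCurve b c σ τ u = τ (u + (c - b)) := by
  rcases h.eq_or_lt with rfl | h
  · rw [concatCurve_of_le le_rfl, hq]; congr 1; ring
  · exact if_neg (not_le.2 h)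

lemma IsPiecewiseSmoothCurve.concat {E : Type*} [NormedAddCommGroup E] [NormedSpace ℝ E]
    [TopologicalSpace M] [ChartedSpace E M] {a b c d : ℝ} {σ τ : ℝ → M}
    (hσ : IsPiecewiseSmoothCurve E a b σ) (hτ : IsPiecewiseSmoothCurve E c d τ)
    (hq : σ b = τ c) : IsPiecewiseSmoothCurve E a (d - (c - b)) (concatCurve b c σ τ) := by
  obtain ⟨k, t, ht, hs⟩ := hσ
  obtain ⟨m, r, hr, hs'⟩ := hτ
  have hlo : ∀ i ≤ k, (if i ≤ k then t i else r (i - k) - (c - b)) = t i := fun i hi ↦ if_pos hi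
  -- The two branches agree at the junction `i = k`, so the second formula holds from `k` on.
  have hhi : ∀ i, k ≤ i → (if i ≤ k then t i else r (i - k) - (c - b)) = r (i - k) - (c - b) := by
    intro i hi
    rcases hi.eq_or_lt with rfl | hi
    · rw [if_pos le_rfl, Nat.sub_self, hr.1, ht.2.1]; ring
    · exact if_neg (not_le.2 hi)
  refine ⟨k + m, fun i ↦ if i ≤ k then t i else r (i - k) - (c - b), ⟨?_, ?_, ?_⟩, ?_⟩
  · simpa using ht.1
  · simp only
    rw [hhi _ (by omega), Nat.add_sub_cancel_left, hr.2.1]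
  · intro i hi
    simp only
    rcases lt_or_ge i k with h | h
    · rw [hlo i h.le, hlo (i + 1) h]; exact ht.2.2 i h
    · rw [hhi i h, hhi (i + 1) (by omega), Nat.sub_add_comm h]
      linarith [hr.2.2 (i - k) (by omega)]
  · intro i hi
    simp only
    rcases lt_or_ge i k with h | h
    · rw [hlo i h.le, hlo (i + 1) h]
      exact (hs i h).congr fun u hu ↦
        concatCurve_of_le (hu.2.trans (ht.mem_Icc (i := i + 1) (by omega)).2)
    · rw [hhi i h, hhi (i + 1) (by omega), Nat.sub_add_comm h]
      have hadd : ContMDiff 𝓘(ℝ, ℝ) 𝓘(ℝ, ℝ) ∞ (fun u : ℝ ↦ u + (c - b)) :=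
        (contDiff_id.add contDiff_const).contMDiff
      refine ((hs' (i - k) (by omega)).comp hadd.contMDiffOn ?_).congr ?_
      · intro u hu
        exact ⟨by linarith [hu.1], by linarith [hu.2]⟩
      · intro u hu
        refine concatCurve_of_ge hq ?_
        have := (hr.mem_Icc (i := i - k) (by omega)).1
        linarith [hu.1]

end

lemma setLIntegral_Ioo_add {f : ℝ → ℝ≥0∞} {a b c : ℝ} (hab : a ≤ b) (hbc : b ≤ c) :
    ∫⁻ t in Ioo a c, f t = (∫⁻ t in Ioo a b, f t) + ∫⁻ t in Ioo b c, f t := by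
  rw [setLIntegral_congr (μ := volume) (Ioo_ae_eq_Ioc (a := a) (b := c)),
    setLIntegral_congr (μ := volume) (Ioo_ae_eq_Ioc (a := a) (b := b)),
    setLIntegral_congr (μ := volume) (Ioo_ae_eq_Ioc (a := b) (b := c)),
    ← Ioc_union_Ioc_eq_Ioc hab hbc,
    lintegral_union measurableSet_Ioc (Ioc_disjoint_Ioc_of_le le_rfl)]

/-! ### Additivity of length and the triangle inequality. -/

namespace FinslerStructure

variable {E : Type*} [NormedAddCommGroup E] [NormedSpace ℝ E]
  {M : Type*} [TopologicalSpace M] [ChartedSpace E M] [IsManifold 𝓘(ℝ, E) ∞ M]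
  (F : FinslerStructure E M)

/-- The speed of a curve, computed with the two-sided derivative. -/
noncomputable def curveSpeed (σ : ℝ → M) (t : ℝ) : ℝ :=
  F.fiberNorm (σ t) (mfderiv 𝓘(ℝ, ℝ) 𝓘(ℝ, E) σ t (1 : ℝ))

lemma curveSpeed_congr {σ τ : ℝ → M} {t : ℝ} (h : σ =ᶠ[𝓝 t] τ) :
    F.curveSpeed σ t = F.curveSpeed τ t := by
  have h1 : (mfderiv 𝓘(ℝ, ℝ) 𝓘(ℝ, E) σ t (1 : ℝ) : E) = mfderiv 𝓘(ℝ, ℝ) 𝓘(ℝ, E) τ t (1 : ℝ) :=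
    congrArg (fun f : ℝ →L[ℝ] E ↦ f 1) h.mfderiv_eq
  unfold curveSpeed
  rw [h.eq_of_nhds]
  exact congrArg (F.fiberNorm (τ t)) h1

lemma curveSpeed_comp_add (τ : ℝ → M) (c t : ℝ) :
    F.curveSpeed (fun u ↦ τ (u + c)) t = F.curveSpeed τ (t + c) := by
  have hadd : ∀ c t : ℝ, HasMFDerivAt 𝓘(ℝ, ℝ) 𝓘(ℝ, ℝ) (fun u : ℝ ↦ u + c) t
      (ContinuousLinearMap.id ℝ ℝ) := fun c t ↦
    ((hasFDerivAt_id t).add_const c).hasMFDerivAt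
  have h1 : (mfderiv 𝓘(ℝ, ℝ) 𝓘(ℝ, E) (fun u ↦ τ (u + c)) t : ℝ →L[ℝ] E)
      = mfderiv 𝓘(ℝ, ℝ) 𝓘(ℝ, E) τ (t + c) := by
    by_cases hτ : MDifferentiableAt 𝓘(ℝ, ℝ) 𝓘(ℝ, E) τ (t + c)
    · have := (hτ.hasMFDerivAt.comp t (hadd c t)).mfderiv
      exact this.trans (ContinuousLinearMap.comp_id (mfderiv 𝓘(ℝ, ℝ) 𝓘(ℝ, E) τ (t + c)))
    -- Translating back shows that both curves fail to be differentiable together, and then both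
    -- derivatives have the default value `0`.
    · have h2 : ¬ MDifferentiableAt 𝓘(ℝ, ℝ) 𝓘(ℝ, E) (fun u ↦ τ (u + c)) t := by
        intro h
        have h' : MDifferentiableAt 𝓘(ℝ, ℝ) 𝓘(ℝ, E) (fun u ↦ τ (u + c)) ((t + c) + -c) := by
          simpa using h
        have := h'.comp (t + c) (hadd (-c) (t + c)).mdifferentiableAt
        simp only [Function.comp_def, neg_add_cancel_right] at this
        exact hτ this
      rw [mfderiv_zero_of_not_mdifferentiableAt h2, mfderiv_zero_of_not_mdifferentiableAt hτ]
      rfl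
  exact congrArg (F.fiberNorm (τ (t + c))) (congrArg (fun f : ℝ →L[ℝ] E ↦ f 1) h1)

/-- End points are null, and the two-sided derivative does not refer to `[a, b]`, so lengths in this
form can be cut and glued. -/
lemma integralLength_eq (a b : ℝ) (σ : ℝ → M) :
    F.integralLength a b σ = ∫⁻ t in Ioo a b, ENNReal.ofReal (F.curveSpeed σ t) := by
  unfold integralLength
  rw [← setLIntegral_congr (μ := volume) Ioo_ae_eq_Icc]
  refine setLIntegral_congr_fun measurableSet_Ioo fun t ht ↦ ?_
  have h : (mfderivWithin 𝓘(ℝ, ℝ) 𝓘(ℝ, E) σ (Icc a b) t : ℝ →L[ℝ] E)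
      = mfderiv 𝓘(ℝ, ℝ) 𝓘(ℝ, E) σ t := mfderivWithin_of_mem_nhds (Icc_mem_nhds ht.1 ht.2)
  exact congrArg (fun f : ℝ →L[ℝ] E ↦ ENNReal.ofReal (F.fiberNorm (σ t) (f 1))) h

lemma integralLength_concat {a b c d : ℝ} (hab : a ≤ b) (hcd : c ≤ d) {σ τ : ℝ → M}
    (hq : σ b = τ c) :
    F.integralLength a (d - (c - b)) (concatCurve b c σ τ)
      = F.integralLength a b σ + F.integralLength c d τ := by
  simp only [integralLength_eq]
  rw [setLIntegral_Ioo_add hab (by linarith : b ≤ d - (c - b))]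
  congr 1
  · refine setLIntegral_congr_fun measurableSet_Ioo fun t ht ↦ ?_
    rw [F.curveSpeed_congr (τ := σ)]
    filter_upwards [gt_mem_nhds ht.2] with u hu using concatCurve_of_le hu.le
  · have h1 : ∀ t ∈ Ioo b (d - (c - b)),
        ENNReal.ofReal (F.curveSpeed (concatCurve b c σ τ) t)
        = ENNReal.ofReal (F.curveSpeed τ (t + (c - b))) := by
      intro t ht
      rw [← F.curveSpeed_comp_add, F.curveSpeed_congr]
      filter_upwards [lt_mem_nhds ht.1] with u hu using concatCurve_of_ge hq hu.le
    rw [setLIntegral_congr_fun measurableSet_Ioo h1]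
    have h2 := (measurePreserving_add_right volume (c - b)).setLIntegral_comp_preimage_emb
      (measurableEmbedding_addRight (c - b)) (fun t ↦ ENNReal.ofReal (F.curveSpeed τ t))
      (Ioo c d)
    rw [← h2]
    congr 2
    ext u
    simp only [mem_preimage, mem_Ioo]
    constructor <;> rintro ⟨h, h'⟩ <;> constructor <;> linarith

lemma dist_le_integralLength {a b : ℝ} {σ : ℝ → M} (h : IsPiecewiseSmoothCurve E a b σ) :
    F.dist (σ a) (σ b) ≤ F.integralLength a b σ :=
  iInf_le_of_le a <| iInf_le_of_le b <| iInf_le_of_le σ <| iInf_le_of_le ⟨h, rfl, rfl⟩ le_rfl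

lemma le_dist_iff {p q : M} {x : ℝ≥0∞} :
    x ≤ F.dist p q ↔ ∀ (a b : ℝ) (σ : ℝ → M), IsPiecewiseSmoothCurve E a b σ → σ a = p → σ b = q →
      x ≤ F.integralLength a b σ := by
  simp only [dist, le_iInf_iff, and_imp]

lemma dist_triangle (p q r : M) : F.dist p r ≤ F.dist p q + F.dist q r := by
  conv_rhs => simp only [dist, ENNReal.iInf_add, ENNReal.add_iInf]
  simp only [le_iInf_iff]
  rintro c d τ ⟨hτ, rfl, rfl⟩ a b σ ⟨hσ, rfl, hq⟩
  rw [← F.integralLength_concat hσ.le hτ.le hq]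
  have := F.dist_le_integralLength (hσ.concat hτ hq)
  rwa [concatCurve_of_le hσ.le, concatCurve_of_ge hq (by linarith [hτ.le]),
    sub_add_cancel] at this

lemma dist_self (p : M) : F.dist p p = 0 := by
  -- A partition with no pieces is allowed when the end points coincide.
  have h : IsPiecewiseSmoothCurve E 0 0 (fun _ : ℝ ↦ p) :=
    ⟨0, fun _ ↦ 0, ⟨rfl, rfl, fun i hi ↦ by omega⟩, fun i hi ↦ by omega⟩
  have := F.dist_le_integralLength h
  simpa [integralLength_eq] using this

lemma dist_le_sum (γ : ℕ → M) (n : ℕ) :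
    F.dist (γ 0) (γ n) ≤ ∑ i ∈ Finset.range n, F.dist (γ i) (γ (i + 1)) := by
  induction n with
  | zero => simp [dist_self]
  | succ n ih =>
    rw [Finset.sum_range_succ]
    exact (F.dist_triangle _ (γ n) _).trans (by gcongr)

end FinslerStructure

/-! ### Lower bounds for length by linear functionals. -/

lemma ofReal_integral_le_lintegral_ofReal {α : Type*} {m : MeasurableSpace α} {μ : Measure α}
    {f : α → ℝ} (hf : Integrable f μ) :
    ENNReal.ofReal (∫ x, f x ∂μ) ≤ ∫⁻ x, ENNReal.ofReal (f x) ∂μ := by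
  rw [integral_eq_lintegral_pos_part_sub_lintegral_neg_part hf]
  exact (ENNReal.ofReal_le_ofReal (sub_le_self _ ENNReal.toReal_nonneg)).trans
    ENNReal.ofReal_toReal_le

namespace FinslerStructure

variable {E : Type*} [NormedAddCommGroup E] [NormedSpace ℝ E]
  {M : Type*} [TopologicalSpace M] [ChartedSpace E M] [IsManifold 𝓘(ℝ, E) ∞ M]
  (F : FinslerStructure E M) (p : M)

/-- The fundamental theorem of calculus for `l` along the curve in coordinates: the integrand
`l(ψ')` is at most the speed. -/
lemma ofReal_support_le_lintegral_of_contMDiffOn [CompleteSpace E] {c d : ℝ} (hcd : c ≤ d)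
    {σ : ℝ → M}
    (hσ : ContMDiffOn 𝓘(ℝ, ℝ) 𝓘(ℝ, E) ∞ σ (Icc c d)) {B : Set E}
    (hsrc : ∀ t ∈ Icc c d, σ t ∈ (chartAt E p).source ∧ chartAt E p (σ t) ∈ B) {l : E →L[ℝ] ℝ}
    (hl : ∀ x ∈ B, ∀ w, l w ≤ F.chartNorm p x w) :
    ENNReal.ofReal (l (chartAt E p (σ d) - chartAt E p (σ c)))
      ≤ ∫⁻ t in Ioo c d, ENNReal.ofReal (F.curveSpeed σ t) := by
  rcases hcd.eq_or_lt with rfl | hlt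
  · simp
  set ψ : ℝ → E := fun t ↦ chartAt E p (σ t) with hψ
  have hψs : ContDiffOn ℝ 1 ψ (Icc c d) := by
    rw [← contMDiffOn_iff_contDiffOn]
    have h1 : ContMDiffOn 𝓘(ℝ, E) 𝓘(ℝ, E) ∞ (chartAt E p) (chartAt E p).source := contMDiffOn_chart
    exact (h1.comp hσ fun t ht ↦ (hsrc t ht).1).of_le (by simp)
  have hlψ : ContDiffOn ℝ 1 (fun t ↦ l (ψ t)) (Icc c d) := l.contDiff.comp_contDiffOn hψs
  have hint := intervalIntegral.integral_derivWithin_Icc_of_contDiffOn_Icc hlψ hcd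
  have hcont : ContinuousOn (derivWithin (fun t ↦ l (ψ t)) (Icc c d)) (Icc c d) :=
    hlψ.continuousOn_derivWithin (uniqueDiffOn_Icc hlt) le_rfl
  have hintble : IntegrableOn (derivWithin (fun t ↦ l (ψ t)) (Icc c d)) (Ioo c d) :=
    hcont.integrableOn_Icc.mono_set Ioo_subset_Icc_self
  rw [map_sub, ← hint, intervalIntegral.integral_of_le hcd, integral_Ioc_eq_integral_Ioo]
  refine (ofReal_integral_le_lintegral_ofReal hintble).trans ?_
  refine setLIntegral_mono' measurableSet_Ioo fun t ht ↦ ENNReal.ofReal_le_ofReal ?_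
  have hmem : Icc c d ∈ 𝓝 t := Icc_mem_nhds ht.1 ht.2
  have hd : HasDerivAt ψ (deriv ψ t) t :=
    ((hψs.contDiffAt hmem).differentiableAt one_ne_zero).hasDerivAt
  have h1 : derivWithin (fun t ↦ l (ψ t)) (Icc c d) t = l (deriv ψ t) := by
    rw [derivWithin_of_mem_nhds hmem]
    exact (l.hasFDerivAt.comp_hasDerivAt t hd).deriv
  have h2 := fiberNorm_mfderivWithin_eq_chartNorm F p (σ := σ) (s := univ) (t := t)
    uniqueDiffWithinAt_univ ((hσ.continuousOn.continuousAt hmem).continuousWithinAt)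
    (hsrc t (Ioo_subset_Icc_self ht)).1 hd.hasDerivWithinAt
  rw [mfderivWithin_univ] at h2
  rw [h1]
  unfold curveSpeed
  rw [h2]
  exact hl _ (hsrc t (Ioo_subset_Icc_self ht)).2 _

/-- A linear functional dominated by the Finsler function bounds the length of the part of a
curve that stays in a chart. -/
lemma ofReal_support_le_lintegral [CompleteSpace E] {a b s : ℝ} {σ : ℝ → M}
    (hσ : IsPiecewiseSmoothCurve E a b σ) (hs : s ∈ Icc a b) {B : Set E}
    (hsrc : ∀ t ∈ Icc a s, σ t ∈ (chartAt E p).source ∧ chartAt E p (σ t) ∈ B) {l : E →L[ℝ] ℝ}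
    (hl : ∀ x ∈ B, ∀ w, l w ≤ F.chartNorm p x w) :
    ENNReal.ofReal (l (chartAt E p (σ s) - chartAt E p (σ a)))
      ≤ ∫⁻ t in Ioo a s, ENNReal.ofReal (F.curveSpeed σ t) := by
  obtain ⟨k, t, ht, hsm⟩ := hσ
  -- The end point `s` varies in the induction, so that the last piece may be cut short.
  have key : ∀ i ≤ k, ∀ s ∈ Icc a (t i),
      (∀ t ∈ Icc a s, σ t ∈ (chartAt E p).source ∧ chartAt E p (σ t) ∈ B) →
      ENNReal.ofReal (l (chartAt E p (σ s) - chartAt E p (σ a)))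
      ≤ ∫⁻ t in Ioo a s, ENNReal.ofReal (F.curveSpeed σ t) := by
    intro i
    induction i with
    | zero =>
      intro _ s hs _
      rw [ht.1, Icc_self, mem_singleton_iff] at hs
      simp [hs]
    | succ n ih =>
      intro hn s hs hsrc
      rcases le_total s (t n) with h | h
      · exact ih (by omega) s ⟨hs.1, h⟩ hsrc
      · have ha : a ≤ t n := (ht.mem_Icc (by omega : n ≤ k)).1
        have h1 := ih (by omega) (t n) ⟨ha, le_rfl⟩ fun u hu ↦ hsrc u ⟨hu.1, hu.2.trans h⟩
        have h2 := F.ofReal_support_le_lintegral_of_contMDiffOn p h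
          ((hsm n (by omega)).mono (Icc_subset_Icc le_rfl hs.2))
          (fun u hu ↦ hsrc u ⟨ha.trans hu.1, hu.2⟩) hl
        rw [setLIntegral_Ioo_add ha h]
        refine le_trans ?_ (add_le_add h1 h2)
        refine le_trans (ENNReal.ofReal_le_ofReal (le_of_eq ?_)) ENNReal.ofReal_add_le
        rw [← map_add]
        congr 1
        abel
  exact key k le_rfl s (ht.2.1 ▸ hs) hsrc

end FinslerStructure

/-! ### Local comparison of the distance with the Finsler function. -/

namespace FinslerStructure

variable {E : Type*} [NormedAddCommGroup E] [NormedSpace ℝ E] [FiniteDimensional ℝ E]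
  {M : Type*} [TopologicalSpace M] [ChartedSpace E M] [IsManifold 𝓘(ℝ, E) ∞ M]
  (F : FinslerStructure E M) (p : M)

/-- In a chart, the Finsler distance is bounded above to first order by the Finsler function. -/
lemma eventually_dist_chartAt_symm_le {x₀ : E} (hx₀ : x₀ ∈ (chartAt E p).target) {ε : ℝ}
    (hε : 0 < ε) :
    ∀ᶠ z : E × E in 𝓝 (x₀, x₀),
      F.dist ((chartAt E p).symm z.1) ((chartAt E p).symm z.2)
        ≤ ENNReal.ofReal (F.chartNorm p x₀ (z.2 - z.1) + ε * ‖z.2 - z.1‖) := by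
  have h := (F.eventually_abs_chartNorm_sub_le p hx₀ hε).and
    ((chartAt E p).open_target.mem_nhds hx₀)
  obtain ⟨r, hr, hball⟩ := Metric.eventually_nhds_iff_ball.1 h
  have hnhds : Metric.ball x₀ r ×ˢ Metric.ball x₀ r ∈ 𝓝 (x₀, x₀) :=
    prod_mem_nhds (Metric.ball_mem_nhds _ hr) (Metric.ball_mem_nhds _ hr)
  filter_upwards [hnhds]
  rintro ⟨x, y⟩ ⟨hx, hy⟩
  simp only at hx hy ⊢
  set v := y - x with hv
  -- The test curve is the coordinate segment; convexity of the ball keeps it where `F` is `ε`-close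
  -- to its value at `x₀`.
  set L : ℝ → E := fun t ↦ x + t • v with hL
  have hLmem : ∀ t ∈ Icc (0 : ℝ) 1, L t ∈ Metric.ball x₀ r := by
    intro t ht
    exact (convex_ball x₀ r).add_smul_sub_mem hx hy ht
  set σ : ℝ → M := fun t ↦ (chartAt E p).symm (L t) with hσ
  have hLs : ContDiff ℝ ∞ L := contDiff_const.add (contDiff_id.smul contDiff_const)
  have hsm : ContMDiffOn 𝓘(ℝ, ℝ) 𝓘(ℝ, E) ∞ σ (Icc 0 1) := by
    have h1 : ContMDiffOn 𝓘(ℝ, E) 𝓘(ℝ, E) ∞ (chartAt E p).symm (chartAt E p).target :=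
      contMDiffOn_chart_symm
    exact h1.comp hLs.contMDiff.contMDiffOn fun t ht ↦ (hball _ (hLmem t ht)).2
  have hps : IsPiecewiseSmoothCurve E 0 1 σ :=
    ⟨1, fun i ↦ i, ⟨by simp, by simp, fun i _ ↦ by simp⟩, fun i hi ↦ by
      obtain rfl : i = 0 := by omega
      simpa using hsm⟩
  have hdist := F.dist_le_integralLength hps
  have h0 : σ 0 = (chartAt E p).symm x := by simp [hσ, hL]
  have h1 : σ 1 = (chartAt E p).symm y := by simp [hσ, hL, hv]
  rw [h0, h1] at hdist
  refine hdist.trans ?_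
  rw [integralLength_eq]
  calc ∫⁻ t in Ioo (0 : ℝ) 1, ENNReal.ofReal (F.curveSpeed σ t)
      ≤ ∫⁻ _ in Ioo (0 : ℝ) 1, ENNReal.ofReal (F.chartNorm p x₀ v + ε * ‖v‖) := by
        refine setLIntegral_mono' measurableSet_Ioo fun t ht ↦ ENNReal.ofReal_le_ofReal ?_
        have ht' := Ioo_subset_Icc_self ht
        have htgt := (hball _ (hLmem t ht')).2
        have hd : HasDerivAt L v t := by
          simpa only [one_smul, id] using ((hasDerivAt_id t).smul_const v).const_add x
        have hev : (fun u ↦ chartAt E p (σ u)) =ᶠ[𝓝 t] L := by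
          filter_upwards [Icc_mem_nhds ht.1 ht.2] with u hu
          exact (chartAt E p).right_inv (hball _ (hLmem u hu)).2
        have h2 := fiberNorm_mfderivWithin_eq_chartNorm F p (σ := σ) (s := univ) (t := t)
          uniqueDiffWithinAt_univ
          ((hsm.continuousOn.continuousAt (Icc_mem_nhds ht.1 ht.2)).continuousWithinAt)
          ((chartAt E p).map_target htgt) (hd.congr_of_eventuallyEq hev).hasDerivWithinAt
        rw [mfderivWithin_univ] at h2
        unfold curveSpeed
        rw [h2, hev.eq_of_nhds]
        have := (abs_le.1 ((hball _ (hLmem t ht')).1 v)).2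
        linarith
    _ = _ := by simp

/-- Near each point of a chart the Finsler function is comparable to the norm from below. -/
lemma exists_closedBall_mul_norm_le {x₀ : E} (hx₀ : x₀ ∈ (chartAt E p).target) :
    ∃ c > 0, ∃ R > 0, Metric.closedBall x₀ R ⊆ (chartAt E p).target ∧
      ∀ x ∈ Metric.closedBall x₀ R, ∀ w, c * ‖w‖ ≤ F.chartNorm p x w := by
  obtain ⟨c, hc, hcn⟩ := F.exists_mul_norm_le_chartNorm p hx₀
  have h := (F.eventually_abs_chartNorm_sub_le p hx₀ (half_pos hc)).and
    ((chartAt E p).open_target.mem_nhds hx₀)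
  obtain ⟨R, hR, hball⟩ := Metric.nhds_basis_closedBall.eventually_iff.1 h
  refine ⟨c / 2, half_pos hc, R, hR, fun x hx ↦ (hball hx).2, fun x hx w ↦ ?_⟩
  have h1 := (abs_le.1 ((hball hx).1 w)).1
  linarith [hcn w]

variable [T2Space M]

/-- A curve that starts inside a coordinate ball either stays inside the ball or its length is at
least a multiple of the distance of the starting point to the boundary. -/
lemma mem_ball_or_le_integralLength {x₀ : E} {r c : ℝ} (hc : 0 < c)
    (htgt : Metric.closedBall x₀ r ⊆ (chartAt E p).target)
    (hcn : ∀ x ∈ Metric.closedBall x₀ r, ∀ w, c * ‖w‖ ≤ F.chartNorm p x w)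
    {a b : ℝ} {σ : ℝ → M} (hσ : IsPiecewiseSmoothCurve E a b σ)
    (ha : σ a ∈ (chartAt E p).source) (hax : chartAt E p (σ a) ∈ Metric.ball x₀ r) :
    (∀ t ∈ Icc a b, σ t ∈ (chartAt E p).source ∧ chartAt E p (σ t) ∈ Metric.ball x₀ r) ∨
      ENNReal.ofReal (c * (r - ‖chartAt E p (σ a) - x₀‖)) ≤ F.integralLength a b σ := by
  have : ProperSpace E := FiniteDimensional.proper ℝ E
  have : CompleteSpace E := FiniteDimensional.complete ℝ E
  set V : Set M := (chartAt E p).source ∩ chartAt E p ⁻¹' Metric.ball x₀ r with hV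
  have hVo : IsOpen V := (chartAt E p).isOpen_inter_preimage Metric.isOpen_ball
  -- Hausdorffness enters here: the compact image of the closed ball is closed in `M`, so at its
  -- first exit from `V` a curve is still in the chart, on the coordinate sphere.
  have hKc : IsClosed ((chartAt E p).symm '' Metric.closedBall x₀ r) :=
    ((isCompact_closedBall x₀ r).image_of_continuousOn
      ((chartAt E p).continuousOn_symm.mono htgt)).isClosed
  have hVK : V ⊆ (chartAt E p).symm '' Metric.closedBall x₀ r := fun q hq ↦
    ⟨chartAt E p q, Metric.ball_subset_closedBall hq.2, (chartAt E p).left_inv hq.1⟩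
  have hKsrc : ∀ q ∈ (chartAt E p).symm '' Metric.closedBall x₀ r,
      q ∈ (chartAt E p).source ∧ chartAt E p q ∈ Metric.closedBall x₀ r := by
    rintro _ ⟨x, hx, rfl⟩
    exact ⟨(chartAt E p).map_target (htgt hx), by rwa [(chartAt E p).right_inv (htgt hx)]⟩
  by_cases hstay : ∀ t ∈ Icc a b, σ t ∈ V
  · exact Or.inl hstay
  right
  push Not at hstay
  have hcont := hσ.continuousOn
  have hZ : IsCompact (Icc a b ∩ σ ⁻¹' Vᶜ) :=
    isCompact_Icc.of_isClosed_subset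
      (hcont.preimage_isClosed_of_isClosed isClosed_Icc hVo.isClosed_compl) inter_subset_left
  obtain ⟨s, ⟨hs, hsV⟩, hmin⟩ := hZ.exists_isLeast
    (let ⟨t, ht, htV⟩ := hstay; ⟨t, ht, htV⟩)
  have has : a < s := by
    rcases hs.1.eq_or_lt with h | h
    · exact absurd ⟨ha, hax⟩ (h ▸ hsV)
    · exact h
  have hlt : ∀ t ∈ Ico a s, σ t ∈ V := by
    intro t ht
    by_contra hn
    exact absurd (hmin ⟨⟨ht.1, ht.2.le.trans hs.2⟩, hn⟩) (not_le.2 ht.2)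
  have hsK : σ s ∈ (chartAt E p).symm '' Metric.closedBall x₀ r := by
    have h1 : s ∈ closure (Ico a s) := by
      rw [closure_Ico has.ne]; exact ⟨has.le, le_rfl⟩
    have h2 : ContinuousWithinAt σ (Ico a s) s :=
      (hcont s hs).mono fun t ht ↦ ⟨ht.1, ht.2.le.trans hs.2⟩
    have h3 : σ '' Ico a s ⊆ (chartAt E p).symm '' Metric.closedBall x₀ r :=
      image_subset_iff.2 fun t ht ↦ hVK (hlt t ht)
    exact closure_minimal h3 hKc (h2.mem_closure_image h1)
  have hsK' := hKsrc _ hsK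
  have hsrc : ∀ t ∈ Icc a s, σ t ∈ (chartAt E p).source ∧
      chartAt E p (σ t) ∈ Metric.closedBall x₀ r := by
    intro t ht
    rcases ht.2.eq_or_lt with rfl | h
    · exact hsK'
    · exact hKsrc _ (hVK (hlt t ⟨ht.1, h⟩))
  have hfar : r ≤ ‖chartAt E p (σ s) - x₀‖ := by
    by_contra hn
    exact hsV ⟨hsK'.1, mem_ball_iff_norm.2 (not_le.1 hn)⟩
  -- A norming functional for the displacement up to the exit time; `c • g` is dominated by `F` on
  -- the closed ball.
  obtain ⟨g, hg1, hg⟩ := exists_dual_vector'' ℝ (chartAt E p (σ s) - chartAt E p (σ a))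
  have hbound : ∀ x ∈ Metric.closedBall x₀ r, ∀ w, (c • g) w ≤ F.chartNorm p x w := by
    intro x hx w
    refine le_trans ?_ (hcn x hx w)
    simp only [FunLike.coe_smul, Pi.smul_apply, smul_eq_mul]
    have : g w ≤ ‖w‖ := (le_abs_self _).trans
      ((g.le_opNorm w).trans (mul_le_of_le_one_left (norm_nonneg _) hg1))
    gcongr
  have hlen := F.ofReal_support_le_lintegral p hσ hs hsrc hbound
  rw [integralLength_eq]
  refine le_trans ?_ (hlen.trans (lintegral_mono_set (Ioo_subset_Ioo_right hs.2)))
  refine ENNReal.ofReal_le_ofReal ?_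
  simp only [FunLike.coe_smul, Pi.smul_apply, smul_eq_mul, hg]
  have := norm_sub_le_norm_sub_add_norm_sub (chartAt E p (σ s)) (chartAt E p (σ a)) x₀
  have : r - ‖chartAt E p (σ a) - x₀‖ ≤ ‖chartAt E p (σ s) - chartAt E p (σ a)‖ := by linarith
  simpa using mul_le_mul_of_nonneg_left this hc.le

lemma ofReal_le_dist_of_notMem {x₀ : E} {r c : ℝ} (hc : 0 < c)
    (htgt : Metric.closedBall x₀ r ⊆ (chartAt E p).target)
    (hcn : ∀ x ∈ Metric.closedBall x₀ r, ∀ w, c * ‖w‖ ≤ F.chartNorm p x w)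
    {x : E} (hx : x ∈ Metric.ball x₀ r) {q : M}
    (hq : ¬ (q ∈ (chartAt E p).source ∧ chartAt E p q ∈ Metric.ball x₀ r)) :
    ENNReal.ofReal (c * (r - ‖x - x₀‖)) ≤ F.dist ((chartAt E p).symm x) q := by
  have hxt := htgt (Metric.ball_subset_closedBall hx)
  rw [le_dist_iff]
  rintro a b σ hσ ha rfl
  have hx' : chartAt E p (σ a) = x := by rw [ha, (chartAt E p).right_inv hxt]
  rcases F.mem_ball_or_le_integralLength p hc htgt hcn hσ (ha ▸ (chartAt E p).map_target hxt)
    (hx' ▸ hx) with h | h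
  · exact absurd (h b ⟨hσ.le, le_rfl⟩) hq
  · rwa [hx'] at h

/-- A curve from `x` to `y` that stays in the ball pays `l (y - x)`; one that leaves it pays for
reaching the boundary. -/
lemma min_le_dist_chartAt_symm {x₀ : E} {r c : ℝ} (hc : 0 < c)
    (htgt : Metric.closedBall x₀ r ⊆ (chartAt E p).target)
    (hcn : ∀ x ∈ Metric.closedBall x₀ r, ∀ w, c * ‖w‖ ≤ F.chartNorm p x w)
    {l : E →L[ℝ] ℝ} (hl : ∀ x ∈ Metric.closedBall x₀ r, ∀ w, l w ≤ F.chartNorm p x w)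
    {x y : E} (hx : x ∈ Metric.ball x₀ r) (hy : y ∈ Metric.ball x₀ r) :
    ENNReal.ofReal (min (l (y - x)) (c * (r - ‖x - x₀‖)))
      ≤ F.dist ((chartAt E p).symm x) ((chartAt E p).symm y) := by
  have : CompleteSpace E := FiniteDimensional.complete ℝ E
  have hxt := htgt (Metric.ball_subset_closedBall hx)
  have hyt := htgt (Metric.ball_subset_closedBall hy)
  rw [le_dist_iff]
  intro a b σ hσ ha hb
  have hx' : chartAt E p (σ a) = x := by rw [ha, (chartAt E p).right_inv hxt]
  have hy' : chartAt E p (σ b) = y := by rw [hb, (chartAt E p).right_inv hyt]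
  rcases F.mem_ball_or_le_integralLength p hc htgt hcn hσ (ha ▸ (chartAt E p).map_target hxt)
    (hx' ▸ hx) with h | h
  · refine (ENNReal.ofReal_le_ofReal (min_le_left _ _)).trans ?_
    have := F.ofReal_support_le_lintegral p hσ ⟨hσ.le, le_rfl⟩
      (fun t ht ↦ ⟨(h t ht).1, Metric.ball_subset_closedBall (h t ht).2⟩) hl
    rwa [hx', hy', ← integralLength_eq] at this
  · rw [hx'] at h
    exact (ENNReal.ofReal_le_ofReal (min_le_right _ _)).trans h

/-- Points at small Finsler distance from `p` are close to `p` in the manifold topology. -/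
lemma exists_forall_dist_lt_mem {U : Set M} (hU : U ∈ 𝓝 p) :
    ∃ δ > 0, ∀ q, F.dist p q < δ → q ∈ U := by
  have hp := mem_chart_source E p
  have hx₀ := mem_chart_target E p
  obtain ⟨c, hc, R, hR, htgt, hcn⟩ := F.exists_closedBall_mul_norm_le p hx₀
  have hU' : (chartAt E p).symm ⁻¹' U ∈ 𝓝 (chartAt E p p) := by
    apply ((chartAt E p).continuousAt_symm hx₀).preimage_mem_nhds
    rwa [(chartAt E p).left_inv hp]
  obtain ⟨r', hr', hball⟩ := Metric.mem_nhds_iff.1 hU'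
  set r := min R r' with hr
  have hr0 : 0 < r := lt_min hR hr'
  have hsub : Metric.closedBall (chartAt E p p) r ⊆ Metric.closedBall (chartAt E p p) R :=
    Metric.closedBall_subset_closedBall (min_le_left _ _)
  refine ⟨ENNReal.ofReal (c * r), by positivity, fun q hq ↦ ?_⟩
  by_contra hqU
  have := F.ofReal_le_dist_of_notMem p hc (hsub.trans htgt) (fun x hx ↦ hcn x (hsub hx))
    (Metric.mem_ball_self hr0) (q := q) (by
      rintro ⟨h1, h2⟩
      have := hball (Metric.ball_subset_ball (min_le_right _ _) h2)
      rw [mem_preimage, (chartAt E p).left_inv h1] at this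
      exact hqU this)
  rw [(chartAt E p).left_inv hp, sub_self, norm_zero, sub_zero] at this
  exact absurd hq (not_lt.2 this)

/-- Used to convert the Lipschitz condition for the Finsler distance into one in coordinates. -/
lemma exists_mul_norm_le_dist_chartAt_symm {x₀ : E} (hx₀ : x₀ ∈ (chartAt E p).target) :
    ∃ c > 0, ∃ U ∈ 𝓝 x₀, ∀ x ∈ U, ∀ y ∈ U, ENNReal.ofReal (c * ‖y - x‖)
      ≤ F.dist ((chartAt E p).symm x) ((chartAt E p).symm y) := by
  obtain ⟨c, hc, R, hR, htgt, hcn⟩ := F.exists_closedBall_mul_norm_le p hx₀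
  have hsub : Metric.ball x₀ (R / 4) ⊆ Metric.ball x₀ R := Metric.ball_subset_ball (by linarith)
  -- With radius `R / 4`, `‖y - x‖ < R / 2 < R - ‖x - x₀‖`, so escaping is never the cheaper
  -- alternative.
  refine ⟨c, hc, Metric.ball x₀ (R / 4), Metric.ball_mem_nhds _ (by positivity),
    fun x hx y hy ↦ ?_⟩
  obtain ⟨g, hg1, hg⟩ := exists_dual_vector'' ℝ (y - x)
  have hbound : ∀ x ∈ Metric.closedBall x₀ R, ∀ w, (c • g) w ≤ F.chartNorm p x w := by
    intro x hx w
    refine le_trans ?_ (hcn x hx w)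
    simp only [FunLike.coe_smul, Pi.smul_apply, smul_eq_mul]
    have : g w ≤ ‖w‖ := (le_abs_self _).trans
      ((g.le_opNorm w).trans (mul_le_of_le_one_left (norm_nonneg _) hg1))
    gcongr
  refine le_trans (ENNReal.ofReal_le_ofReal ?_)
    (F.min_le_dist_chartAt_symm p hc htgt hcn hbound (hsub hx) (hsub hy))
  simp only [FunLike.coe_smul, Pi.smul_apply, smul_eq_mul, hg]
  rw [mem_ball_iff_norm] at hx hy
  have h1 := norm_sub_le_norm_sub_add_norm_sub y x₀ x
  rw [norm_sub_rev x₀ x] at h1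
  refine le_min (by simp) ?_
  gcongr
  linarith

/-- In a chart, the Finsler distance is bounded below to first order by each linear functional
that supports the Finsler function. -/
lemma eventually_le_dist_chartAt_symm {x₀ : E} (hx₀ : x₀ ∈ (chartAt E p).target) {ε : ℝ}
    (hε : 0 < ε) (hε1 : ε < 1) {l : E →L[ℝ] ℝ} (hl : ∀ w, l w ≤ F.chartNorm p x₀ w) :
    ∀ᶠ z : E × E in 𝓝 (x₀, x₀), ENNReal.ofReal ((1 - ε) * l (z.2 - z.1))
        ≤ F.dist ((chartAt E p).symm z.1) ((chartAt E p).symm z.2) := by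
  obtain ⟨c₀, hc₀, hcn₀⟩ := F.exists_mul_norm_le_chartNorm p hx₀
  obtain ⟨c, hc, R, hR, htgt, hcn⟩ := F.exists_closedBall_mul_norm_le p hx₀
  -- The tolerance `ε * c₀` makes the error at most `ε F(x₀, w)`, hence `F(x, w) ≥ (1 - ε) F(x₀,
  -- w)`.
  obtain ⟨r', hr', hball⟩ := Metric.nhds_basis_closedBall.eventually_iff.1
    (F.eventually_abs_chartNorm_sub_le p hx₀ (mul_pos hε hc₀))
  set r := min R r' with hr
  have hr0 : 0 < r := lt_min hR hr'
  have hsub : Metric.closedBall x₀ r ⊆ Metric.closedBall x₀ R :=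
    Metric.closedBall_subset_closedBall (min_le_left _ _)
  have hsub' : Metric.closedBall x₀ r ⊆ Metric.closedBall x₀ r' :=
    Metric.closedBall_subset_closedBall (min_le_right _ _)
  have hbound : ∀ x ∈ Metric.closedBall x₀ r, ∀ w, ((1 - ε) • l) w ≤ F.chartNorm p x w := by
    intro x hx w
    have h1 := (abs_le.1 (hball (hsub' hx) w)).1
    have h2 := mul_le_mul_of_nonneg_left (hcn₀ w) hε.le
    have h3 := mul_le_mul_of_nonneg_left (hl w) (by linarith : 0 ≤ 1 - ε)
    simp only [FunLike.coe_smul, Pi.smul_apply, smul_eq_mul]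
    linarith
  have hnhds : Metric.ball x₀ (r / 2) ×ˢ Metric.ball x₀ (r / 2) ∈ 𝓝 (x₀, x₀) :=
    prod_mem_nhds (Metric.ball_mem_nhds _ (by positivity)) (Metric.ball_mem_nhds _ (by positivity))
  -- Escaping from the half ball costs at least `c * (r / 2)`, more than the functional demands near
  -- the diagonal.
  have hsmall : ∀ᶠ z : E × E in 𝓝 (x₀, x₀), (1 - ε) * l (z.2 - z.1) < c * (r / 2) := by
    have : Continuous fun z : E × E ↦ (1 - ε) * l (z.2 - z.1) := by fun_prop
    exact (this.tendsto (x₀, x₀)).eventually_lt_const (by simp; positivity)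
  filter_upwards [hnhds, hsmall]
  rintro ⟨x, y⟩ ⟨hx, hy⟩ hxy
  simp only at hx hy hxy ⊢
  have hhalf : Metric.ball x₀ (r / 2) ⊆ Metric.ball x₀ r := Metric.ball_subset_ball (by linarith)
  refine le_trans (ENNReal.ofReal_le_ofReal ?_)
    (F.min_le_dist_chartAt_symm p hc (hsub.trans htgt) (fun x hx ↦ hcn x (hsub hx)) hbound
      (hhalf hx) (hhalf hy))
  refine le_min le_rfl (hxy.le.trans ?_)
  rw [mem_ball_iff_norm] at hx
  gcongr
  linarith

end FinslerStructure

/-! ### The metric derivative and differentiability almost everywhere. -/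

/-- The difference quotients of a differentiable function over intervals that shrink to a point
converge to the derivative. -/
lemma HasDerivWithinAt.tendsto_inv_smul_sub {E : Type*} [NormedAddCommGroup E] [NormedSpace ℝ E]
    {ψ : ℝ → E} {v : E} {s : Set ℝ} {t : ℝ} (h : HasDerivWithinAt ψ v s t) {a b : ℕ → ℝ}
    (has : ∀ n, a n ∈ s) (hbs : ∀ n, b n ∈ s) (hat : ∀ n, a n ≤ t) (htb : ∀ n, t ≤ b n)
    (hab : ∀ n, a n < b n) (ha : Tendsto a atTop (𝓝 t)) (hb : Tendsto b atTop (𝓝 t)) :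
    Tendsto (fun n ↦ (b n - a n)⁻¹ • (ψ (b n) - ψ (a n))) atTop (𝓝 v) := by
  have h0 := hasDerivWithinAt_iff_isLittleO.1 h
  have h1 : (fun n ↦ ψ (a n) - ψ t - (a n - t) • v) =o[atTop] fun n ↦ b n - a n :=
    (h0.comp_tendsto (tendsto_nhdsWithin_iff.2 ⟨ha, .of_forall has⟩)).trans_isBigO
      (Asymptotics.IsBigO.of_bound 1 (.of_forall fun n ↦ by
        simp only [Function.comp_def, Real.norm_eq_abs, one_mul]
        rw [abs_of_nonpos (by linarith [hat n]), abs_of_pos (by linarith [hab n])]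
        linarith [htb n]))
  have h2 : (fun n ↦ ψ (b n) - ψ t - (b n - t) • v) =o[atTop] fun n ↦ b n - a n :=
    (h0.comp_tendsto (tendsto_nhdsWithin_iff.2 ⟨hb, .of_forall hbs⟩)).trans_isBigO
      (Asymptotics.IsBigO.of_bound 1 (.of_forall fun n ↦ by
        simp only [Function.comp_def, Real.norm_eq_abs, one_mul]
        rw [abs_of_nonneg (by linarith [htb n]), abs_of_pos (by linarith [hab n])]
        linarith [hat n]))
  have h3 := (h2.sub h1).tendsto_inv_smul_nhds_zero
  refine tendsto_sub_nhds_zero_iff.1 ?_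
  refine h3.congr fun n ↦ ?_
  have h4 : b n - a n ≠ 0 := (sub_pos.2 (hab n)).ne'
  have h5 : v = (b n - a n)⁻¹ • (b n - a n) • v := by
    rw [smul_smul, inv_mul_cancel₀ h4, one_smul]
  conv_rhs => rw [h5]
  rw [← smul_sub]
  congr 1
  module

namespace FinslerStructure

variable {E : Type*} [NormedAddCommGroup E] [NormedSpace ℝ E] [FiniteDimensional ℝ E]
  {M : Type*} [TopologicalSpace M] [T2Space M] [ChartedSpace E M] [IsManifold 𝓘(ℝ, E) ∞ M]
  (F : FinslerStructure E M)

/-- At a point of differentiability the speed is the metric derivative, along intervals that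
shrink to the point. -/
lemma tendsto_dist_div {A B : ℝ} (hAB : A < B) {γ : ℝ → M} {t : ℝ} (ht : t ∈ Icc A B)
    (hγ : MDifferentiableWithinAt 𝓘(ℝ, ℝ) 𝓘(ℝ, E) γ (Icc A B) t) {a b : ℕ → ℝ}
    (has : ∀ n, a n ∈ Icc A B) (hbs : ∀ n, b n ∈ Icc A B) (hat : ∀ n, a n ≤ t)
    (htb : ∀ n, t ≤ b n)
    (hab : ∀ n, a n < b n) (ha : Tendsto a atTop (𝓝 t)) (hb : Tendsto b atTop (𝓝 t)) :
    Tendsto (fun n ↦ F.dist (γ (a n)) (γ (b n)) / ENNReal.ofReal (b n - a n)) atTop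
      (𝓝 (ENNReal.ofReal (F.speed A B γ t))) := by
  set p := γ t with hp
  set ψ : ℝ → E := fun u ↦ chartAt E p (γ u) with hψ
  have hsrc : γ t ∈ (chartAt E p).source := mem_chart_source E p
  have hx₀ : ψ t ∈ (chartAt E p).target := mem_chart_target E p
  have hd := (differentiableWithinAt_chartAt_comp p hγ hsrc).hasDerivWithinAt
  set v := derivWithin ψ (Icc A B) t
  have hspeed : F.speed A B γ t = F.chartNorm p (ψ t) v :=
    fiberNorm_mfderivWithin_eq_chartNorm F p (uniqueDiffOn_Icc hAB t ht)
      hγ.continuousWithinAt hsrc hd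
  set q : ℕ → E := fun n ↦ (b n - a n)⁻¹ • (ψ (b n) - ψ (a n)) with hq
  have hqv : Tendsto q atTop (𝓝 v) := hd.tendsto_inv_smul_sub has hbs hat htb hab ha hb
  have hpos : ∀ n, 0 < b n - a n := fun n ↦ sub_pos.2 (hab n)
  have hqsub : ∀ n, ψ (b n) - ψ (a n) = (b n - a n) • q n := fun n ↦ by
    simp only [hq]
    rw [smul_smul, mul_inv_cancel₀ (hpos n).ne', one_smul]
  have ha' := tendsto_nhdsWithin_iff.2 ⟨ha, .of_forall has⟩
  have hb' := tendsto_nhdsWithin_iff.2 ⟨hb, .of_forall hbs⟩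
  have hψpair : Tendsto (fun n ↦ (ψ (a n), ψ (b n))) atTop (𝓝 (ψ t, ψ t)) :=
    (hd.continuousWithinAt.tendsto.comp ha').prodMk_nhds (hd.continuousWithinAt.tendsto.comp hb')
  have hsa : ∀ᶠ n in atTop, (chartAt E p).symm (ψ (a n)) = γ (a n) := by
    filter_upwards [(hγ.continuousWithinAt.tendsto.comp ha').eventually
      ((chartAt E p).open_source.mem_nhds hsrc)] with n hn using (chartAt E p).left_inv hn
  have hsb : ∀ᶠ n in atTop, (chartAt E p).symm (ψ (b n)) = γ (b n) := by
    filter_upwards [(hγ.continuousWithinAt.tendsto.comp hb').eventually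
      ((chartAt E p).open_source.mem_nhds hsrc)] with n hn using (chartAt E p).left_inv hn
  have hne : ∀ n, ENNReal.ofReal (b n - a n) ≠ 0 := fun n ↦ by simpa using hpos n
  have hcont := F.continuous_chartNorm p hx₀
  rw [hspeed]
  refine tendsto_order.2 ⟨fun c hc ↦ ?_, fun c hc ↦ ?_⟩
  -- Lower bound: the functional supports at the limit velocity `v`, so for small `ε` the value `(1
  -- - ε) * l v` still exceeds `c`.
  · obtain ⟨l, hlv, hl⟩ := F.exists_support_chartNorm p (ψ t) v
    have hT : Tendsto (fun ε : ℝ ↦ ENNReal.ofReal ((1 - ε) * l v)) (𝓝[>] 0)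
        (𝓝 (ENNReal.ofReal (F.chartNorm p (ψ t) v))) := by
      have : Continuous fun ε : ℝ ↦ ENNReal.ofReal ((1 - ε) * l v) :=
        ENNReal.continuous_ofReal.comp (by fun_prop)
      have h := (this.tendsto 0).mono_left (nhdsWithin_le_nhds (s := Ioi 0))
      simpa [hlv] using h
    obtain ⟨ε, hcε, hε0, hε1⟩ :=
      ((hT.eventually_const_lt hc).and (Ioo_mem_nhdsGT one_pos)).exists
    have hlim : Tendsto (fun n ↦ ENNReal.ofReal ((1 - ε) * l (q n))) atTop
        (𝓝 (ENNReal.ofReal ((1 - ε) * l v))) :=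
      (ENNReal.continuous_ofReal.comp (by fun_prop : Continuous fun w ↦ (1 - ε) * l w)).tendsto v
        |>.comp hqv
    filter_upwards [hlim.eventually_const_lt hcε, hsa, hsb,
      hψpair.eventually (F.eventually_le_dist_chartAt_symm p hx₀ hε0 hε1 hl)] with n h1 h2 h3 h4
    simp only [h2, h3] at h4
    refine h1.trans_le ((ENNReal.le_div_iff_mul_le (Or.inl (hne n))
      (Or.inl ENNReal.ofReal_ne_top)).2 ?_)
    rw [← ENNReal.ofReal_mul' (hpos n).le]
    refine le_trans (ENNReal.ofReal_le_ofReal (le_of_eq ?_)) h4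
    rw [hqsub, map_smul l (b n - a n) (q n), smul_eq_mul]
    ring
  -- Upper bound, from coordinate segments.
  · have hT : Tendsto (fun ε : ℝ ↦ ENNReal.ofReal (F.chartNorm p (ψ t) v + ε * ‖v‖)) (𝓝[>] 0)
        (𝓝 (ENNReal.ofReal (F.chartNorm p (ψ t) v))) := by
      have : Continuous fun ε : ℝ ↦ ENNReal.ofReal (F.chartNorm p (ψ t) v + ε * ‖v‖) :=
        ENNReal.continuous_ofReal.comp (by fun_prop)
      have h := (this.tendsto 0).mono_left (nhdsWithin_le_nhds (s := Ioi 0))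
      simpa using h
    obtain ⟨ε, hcε, hε0⟩ :=
      ((hT.eventually_lt_const hc).and self_mem_nhdsWithin).exists
    have hlim : Tendsto (fun n ↦ ENNReal.ofReal (F.chartNorm p (ψ t) (q n) + ε * ‖q n‖)) atTop
        (𝓝 (ENNReal.ofReal (F.chartNorm p (ψ t) v + ε * ‖v‖))) :=
      (ENNReal.continuous_ofReal.comp (by fun_prop :
        Continuous fun w ↦ F.chartNorm p (ψ t) w + ε * ‖w‖)).tendsto v |>.comp hqv
    filter_upwards [hlim.eventually_lt_const hcε, hsa, hsb,
      hψpair.eventually (F.eventually_dist_chartAt_symm_le p hx₀ hε0)] with n h1 h2 h3 h4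
    simp only [h2, h3] at h4
    refine lt_of_le_of_lt (ENNReal.div_le_of_le_mul ?_) h1
    rw [← ENNReal.ofReal_mul' (hpos n).le]
    refine h4.trans (ENNReal.ofReal_le_ofReal (le_of_eq ?_))
    rw [hqsub, F.chartNorm_smul_of_pos p _ _ (hpos n), norm_smul, Real.norm_eq_abs,
      abs_of_pos (hpos n)]
    ring

variable {F}

lemma IsLipschitzCurve.continuousOn {A B : ℝ} {γ : ℝ → M} (hγ : F.IsLipschitzCurve A B γ) :
    ContinuousOn γ (Icc A B) := by
  obtain ⟨K, hK⟩ := hγ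
  intro t ht U hU
  obtain ⟨δ, hδ, hmem⟩ := F.exists_forall_dist_lt_mem (γ t) hU
  have hlim : Tendsto (fun s : ℝ ↦ (K : ℝ≥0∞) * ENNReal.ofReal |t - s|) (𝓝 t) (𝓝 0) := by
    have h : Continuous fun s : ℝ ↦ ENNReal.ofReal |t - s| :=
      ENNReal.continuous_ofReal.comp (by fun_prop)
    have := ENNReal.Tendsto.const_mul (a := (K : ℝ≥0∞)) (h.tendsto t)
      (Or.inr ENNReal.coe_ne_top)
    simpa using this
  rw [mem_map]
  filter_upwards [nhdsWithin_le_nhds (hlim.eventually_lt_const hδ), self_mem_nhdsWithin]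
    with s hs hsI using hmem _ ((hK t ht s hsI).trans_lt hs)

/-- A Lipschitz curve is differentiable almost everywhere. -/
lemma IsLipschitzCurve.ae_mdifferentiableWithinAt {A B : ℝ} {γ : ℝ → M}
    (hγ : F.IsLipschitzCurve A B γ) :
    ∀ᵐ t ∂(volume.restrict (Icc A B)),
      MDifferentiableWithinAt 𝓘(ℝ, ℝ) 𝓘(ℝ, E) γ (Icc A B) t := by
  have hcont := hγ.continuousOn
  obtain ⟨K, hK⟩ := hγ
  rw [ae_restrict_iff' measurableSet_Icc, ae_iff]
  -- One chart need not contain the curve, so the exceptional set is shown to be null near each of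
  -- its points.
  refine measure_null_of_locally_null _ fun t₀ ht₀ ↦ ?_
  obtain ⟨ht₀, -⟩ : t₀ ∈ Icc A B ∧ _ := by simpa only [mem_ofPred_eq, Classical.not_imp] using ht₀
  set p := γ t₀ with hp
  have hsrc : γ t₀ ∈ (chartAt E p).source := mem_chart_source E p
  obtain ⟨c, hc, U, hU, hlow⟩ := F.exists_mul_norm_le_dist_chartAt_symm p (mem_chart_target E p)
  have hW : (chartAt E p).source ∩ chartAt E p ⁻¹' U ∈ 𝓝 (γ t₀) :=
    inter_mem ((chartAt E p).open_source.mem_nhds hsrc)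
      (((chartAt E p).continuousAt hsrc).preimage_mem_nhds hU)
  obtain ⟨δ, hδ, hball⟩ := Metric.mem_nhdsWithin_iff.1
    ((hcont t₀ ht₀).preimage_mem_nhdsWithin hW)
  set J := Metric.ball t₀ δ ∩ Icc A B with hJ
  set ψ : ℝ → E := fun u ↦ chartAt E p (γ u) with hψ
  have hlip : LipschitzOnWith (K / c).toNNReal ψ J := by
    refine LipschitzOnWith.of_dist_le_mul fun s hs t ht ↦ ?_
    have h1 := hlow (ψ t) (hball ht).2 (ψ s) (hball hs).2
    rw [(chartAt E p).left_inv (hball hs).1, (chartAt E p).left_inv (hball ht).1] at h1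
    have h2 := h1.trans (hK t ht.2 s hs.2)
    rw [← ENNReal.ofReal_coe_nnreal, ← ENNReal.ofReal_mul K.coe_nonneg,
      ENNReal.ofReal_le_ofReal_iff (by positivity)] at h2
    rw [dist_eq_norm, Real.dist_eq, abs_sub_comm, Real.coe_toNNReal _ (by positivity),
      div_mul_eq_mul_div, le_div_iff₀ hc]
    linarith
  have hae := hlip.ae_differentiableWithinAt_of_mem_real
  rw [ae_iff] at hae
  refine ⟨_, ?_, hae⟩
  refine Metric.mem_nhdsWithin_iff.2 ⟨δ, hδ, ?_⟩
  rintro t ⟨htb, htN⟩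
  obtain ⟨htI, htn⟩ : t ∈ Icc A B ∧ _ := by
    simpa only [mem_ofPred_eq, Classical.not_imp] using htN
  simp only [mem_ofPred_eq, Classical.not_imp]
  refine ⟨⟨htb, htI⟩, fun hd ↦ htn ?_⟩
  have hd' : DifferentiableWithinAt ℝ ψ (Icc A B) t := by
    rw [hJ, inter_comm] at hd
    exact (differentiableWithinAt_inter (Metric.isOpen_ball.mem_nhds htb)).1 hd
  exact (hasMFDerivWithinAt_of_chartAt_comp p (hcont t htI) (hball ⟨htb, htI⟩).1
    hd'.hasDerivWithinAt).mdifferentiableWithinAt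

end FinslerStructure

/-! ### Grid sums and their limit. -/

lemma setLIntegral_natFloor (D : ℕ → ℝ≥0∞) (a : ℝ) {h : ℝ} (hh : 0 < h) (m : ℕ) :
    ∫⁻ t in Ioo a (a + m * h), D ⌊(t - a) / h⌋₊ = ∑ i ∈ Finset.range m, D i * ENNReal.ofReal h := by
  induction m with
  | zero => simp
  | succ m ih =>
    have h1 : a ≤ a + m * h := by have : 0 ≤ m * h := by positivity
                                  linarith
    have h2 : a + m * h ≤ a + (m + 1 : ℕ) * h := by push_cast; linarith
    rw [setLIntegral_Ioo_add h1 h2, ih, Finset.sum_range_succ]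
    congr 1
    have h3 : ∀ t ∈ Ioo (a + m * h) (a + (m + 1 : ℕ) * h), D ⌊(t - a) / h⌋₊ = D m := by
      intro t ht
      congr 1
      rw [Nat.floor_eq_iff (div_nonneg (by linarith [ht.1]) hh.le), le_div_iff₀ hh, div_lt_iff₀ hh]
      have := ht.2
      push_cast at this
      exact ⟨by linarith [ht.1], by linarith⟩
    rw [setLIntegral_congr_fun measurableSet_Ioo h3, setLIntegral_const, Real.volume_Ioo]
    congr 2
    push_cast
    ring

namespace FinslerStructure

variable {E : Type*} [NormedAddCommGroup E] [NormedSpace ℝ E]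
  {M : Type*} [TopologicalSpace M] [ChartedSpace E M] [IsManifold 𝓘(ℝ, E) ∞ M]
  (F : FinslerStructure E M)

/-- The difference quotient of the Finsler distance along `γ` over the `i`-th interval of the grid
`a, a + h, a + 2h, …`. -/
noncomputable def gridQuotient (γ : ℝ → M) (a h : ℝ) (i : ℕ) : ℝ≥0∞ :=
  F.dist (γ (a + i * h)) (γ (a + (i + 1 : ℕ) * h)) / ENNReal.ofReal h

variable {F}

lemma gridQuotient_le {A B : ℝ} {γ : ℝ → M} {K : ℝ≥0}
    (hK : ∀ s ∈ Icc A B, ∀ t ∈ Icc A B, F.dist (γ s) (γ t) ≤ K * ENNReal.ofReal |s - t|)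
    {a h : ℝ} {i : ℕ} (hh : 0 < h) (h1 : a + i * h ∈ Icc A B)
    (h2 : a + (i + 1 : ℕ) * h ∈ Icc A B) : F.gridQuotient γ a h i ≤ K := by
  refine ENNReal.div_le_of_le_mul ((hK _ h1 _ h2).trans (le_of_eq ?_))
  congr 2
  push_cast
  rw [abs_sub_comm, show a + ((i : ℝ) + 1) * h - (a + i * h) = h by ring, abs_of_pos hh]

lemma lintegral_gridQuotient (γ : ℝ → M) (a : ℝ) {h : ℝ} (hh : 0 < h) (m : ℕ) :
    ∫⁻ t in Ioo a (a + m * h), F.gridQuotient γ a h ⌊(t - a) / h⌋₊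
      = ∑ i ∈ Finset.range m, F.dist (γ (a + i * h)) (γ (a + (i + 1 : ℕ) * h)) := by
  rw [setLIntegral_natFloor _ _ hh]
  refine Finset.sum_congr rfl fun i _ ↦ ?_
  exact ENNReal.div_mul_cancel (by simpa using hh) ENNReal.ofReal_ne_top

lemma measurable_gridQuotient (γ : ℝ → M) (a h : ℝ) :
    Measurable fun t : ℝ ↦ F.gridQuotient γ a h ⌊(t - a) / h⌋₊ := by
  have : Measurable fun t : ℝ ↦ ⌊(t - a) / h⌋₊ := by fun_prop
  exact (measurable_from_nat (f := F.gridQuotient γ a h)).comp this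

/-- The grid points adjacent to a point of `(a, b)`, for the uniform grid with `n + 1` intervals. -/
lemma grid_bounds {a b t : ℝ} (ht : t ∈ Ioo a b) (n : ℕ) :
    0 < (b - a) / (n + 1) ∧
    a + (⌊(t - a) / ((b - a) / (n + 1))⌋₊ : ℕ) * ((b - a) / (n + 1)) ∈ Icc a t ∧
    a + (⌊(t - a) / ((b - a) / (n + 1))⌋₊ + 1 : ℕ) * ((b - a) / (n + 1)) ∈ Icc t b := by
  have hab : 0 < b - a := by linarith [ht.1, ht.2]
  have hn : (0 : ℝ) < n + 1 := by positivity
  have hh : 0 < (b - a) / (n + 1) := by positivity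
  set h := (b - a) / (n + 1) with hdef
  have hta : 0 ≤ (t - a) / h := div_nonneg (by linarith [ht.1]) hh.le
  have h1 := Nat.floor_le hta
  have h2 := Nat.lt_floor_add_one ((t - a) / h)
  rw [le_div_iff₀ hh] at h1
  rw [div_lt_iff₀ hh] at h2
  have hbh : (n + 1) * h = b - a := by rw [hdef]; field_simp
  have h3 : ⌊(t - a) / h⌋₊ < n + 1 := by
    rw [Nat.floor_lt hta, div_lt_iff₀ hh]
    push_cast
    rw [hbh]
    linarith [ht.2]
  have h4 : ((⌊(t - a) / h⌋₊ + 1 : ℕ) : ℝ) ≤ n + 1 := by exact_mod_cast h3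
  have h5 := mul_le_mul_of_nonneg_right h4 hh.le
  have h6 : 0 ≤ (⌊(t - a) / h⌋₊ : ℝ) * h := by positivity
  refine ⟨hh, ⟨by linarith, by linarith⟩, ⟨?_, by linarith⟩⟩
  push_cast
  linarith

lemma gridQuotient_floor_le {A B a b : ℝ} (hA : A ≤ a) (hB : b ≤ B) {γ : ℝ → M} {K : ℝ≥0}
    (hK : ∀ s ∈ Icc A B, ∀ t ∈ Icc A B, F.dist (γ s) (γ t) ≤ K * ENNReal.ofReal |s - t|)
    {t : ℝ} (ht : t ∈ Ioo a b) (n : ℕ) :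
    F.gridQuotient γ a ((b - a) / (n + 1)) ⌊(t - a) / ((b - a) / (n + 1))⌋₊ ≤ K := by
  obtain ⟨hh, h1, h2⟩ := grid_bounds ht n
  exact gridQuotient_le hK hh ⟨hA.trans h1.1, (h1.2.trans ht.2.le).trans hB⟩
    ⟨hA.trans (ht.1.le.trans h2.1), h2.2.trans hB⟩

variable [FiniteDimensional ℝ E] [T2Space M]

/-- The grid interval around `t` shrinks to `t`, so the quotient tends to the metric derivative. -/
lemma tendsto_gridQuotient {A B a b : ℝ} (hA : A ≤ a) (hB : b ≤ B) {γ : ℝ → M} {t : ℝ}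
    (ht : t ∈ Ioo a b) (hγ : MDifferentiableWithinAt 𝓘(ℝ, ℝ) 𝓘(ℝ, E) γ (Icc A B) t) :
    Tendsto (fun n : ℕ ↦ F.gridQuotient γ a ((b - a) / (n + 1))
      ⌊(t - a) / ((b - a) / (n + 1))⌋₊) atTop (𝓝 (ENNReal.ofReal (F.speed A B γ t))) := by
  have hg := grid_bounds ht
  have hdiff : ∀ n : ℕ, (a + (⌊(t - a) / ((b - a) / (n + 1))⌋₊ + 1 : ℕ) * ((b - a) / (n + 1)))
      - (a + (⌊(t - a) / ((b - a) / (n + 1))⌋₊ : ℕ) * ((b - a) / (n + 1)))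
      = (b - a) / (n + 1) := fun n ↦ by push_cast; ring
  have hlim : Tendsto (fun n : ℕ ↦ (b - a) / ((n : ℝ) + 1)) atTop (𝓝 0) := by
    simpa [div_eq_mul_inv] using tendsto_one_div_add_atTop_nhds_zero_nat.const_mul (b - a)
  have key := F.tendsto_dist_div (A := A) (B := B) (by linarith [ht.1, ht.2])
    ⟨by linarith [ht.1], by linarith [ht.2]⟩ hγ
    (a := fun n : ℕ ↦ a + (⌊(t - a) / ((b - a) / (n + 1))⌋₊ : ℕ) * ((b - a) / (n + 1)))
    (b := fun n : ℕ ↦ a + (⌊(t - a) / ((b - a) / (n + 1))⌋₊ + 1 : ℕ) * ((b - a) / (n + 1)))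
    (fun n ↦ ⟨hA.trans (hg n).2.1.1, ((hg n).2.1.2.trans ht.2.le).trans hB⟩)
    (fun n ↦ ⟨hA.trans (ht.1.le.trans (hg n).2.2.1), (hg n).2.2.2.trans hB⟩)
    (fun n ↦ (hg n).2.1.2) (fun n ↦ (hg n).2.2.1)
    (fun n ↦ by linarith [hdiff n, (hg n).1])
    (tendsto_of_tendsto_of_tendsto_of_le_of_le (by simpa using tendsto_const_nhds.sub hlim)
      tendsto_const_nhds (fun n ↦ by linarith [hdiff n, (hg n).2.2.1]) (fun n ↦ (hg n).2.1.2))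
    (tendsto_of_tendsto_of_tendsto_of_le_of_le tendsto_const_nhds
      (by simpa using tendsto_const_nhds.add hlim) (fun n ↦ (hg n).2.2.1)
      (fun n ↦ by linarith [hdiff n, (hg n).2.1.2]))
  simp only [hdiff] at key
  exact key

lemma IsLipschitzCurve.ae_restrict_Ioo {A B a b : ℝ} (hA : A ≤ a) (hB : b ≤ B) {γ : ℝ → M}
    (hγ : F.IsLipschitzCurve A B γ) :
    ∀ᵐ t ∂(volume.restrict (Ioo a b)), t ∈ Ioo a b ∧
      MDifferentiableWithinAt 𝓘(ℝ, ℝ) 𝓘(ℝ, E) γ (Icc A B) t :=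
  (ae_restrict_mem measurableSet_Ioo).and <|
    ae_restrict_of_ae_restrict_of_subset
      (Ioo_subset_Icc_self.trans (Icc_subset_Icc hA hB)) hγ.ae_mdifferentiableWithinAt

/-- The sums of the distances over uniform grids converge to the integral of the speed. -/
lemma IsLipschitzCurve.tendsto_sum_dist {A B a b : ℝ} (hA : A ≤ a) (hab : a < b) (hB : b ≤ B)
    {γ : ℝ → M} (hγ : F.IsLipschitzCurve A B γ) :
    Tendsto (fun n : ℕ ↦ ∑ i ∈ Finset.range (n + 1),
      F.dist (γ (a + i * ((b - a) / (n + 1)))) (γ (a + (i + 1 : ℕ) * ((b - a) / (n + 1)))))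
      atTop (𝓝 (∫⁻ t in Ioo a b, ENNReal.ofReal (F.speed A B γ t))) := by
  have hae := hγ.ae_restrict_Ioo hA hB
  obtain ⟨K, hK⟩ := hγ
  have key := tendsto_lintegral_of_dominated_convergence (μ := volume.restrict (Ioo a b))
    (F := fun (n : ℕ) t ↦ F.gridQuotient γ a ((b - a) / (n + 1))
      ⌊(t - a) / ((b - a) / (n + 1))⌋₊)
    (f := fun t ↦ ENNReal.ofReal (F.speed A B γ t)) (fun _ ↦ (K : ℝ≥0∞))
    (fun n ↦ measurable_gridQuotient γ a _)
    (fun n ↦ by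
      filter_upwards [ae_restrict_mem measurableSet_Ioo] with t ht
        using gridQuotient_floor_le hA hB hK ht n)
    (by
      rw [lintegral_const, Measure.restrict_apply_univ, Real.volume_Ioo]
      exact ENNReal.mul_ne_top ENNReal.coe_ne_top ENNReal.ofReal_ne_top)
    (by filter_upwards [hae] with t ht using tendsto_gridQuotient hA hB ht.1 ht.2)
  refine key.congr fun n ↦ ?_
  have hb : b = a + (n + 1 : ℕ) * ((b - a) / (n + 1)) := by push_cast; field_simp; ring
  rw [← lintegral_gridQuotient γ a (div_pos (sub_pos.2 hab) (by positivity)) (n + 1), ← hb]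

/-- Measurability comes from the speed being an almost everywhere limit of step functions. -/
lemma IsLipschitzCurve.aemeasurable_ofReal_speed {A B : ℝ} {γ : ℝ → M}
    (hγ : F.IsLipschitzCurve A B γ) :
    AEMeasurable (fun t ↦ ENNReal.ofReal (F.speed A B γ t)) (volume.restrict (Ioo A B)) :=
  aemeasurable_of_tendsto_metrizable_ae atTop
    (fun n : ℕ ↦ (measurable_gridQuotient (F := F) γ A ((B - A) / (n + 1))).aemeasurable) (by
      filter_upwards [hγ.ae_restrict_Ioo le_rfl le_rfl] with t ht
        using tendsto_gridQuotient le_rfl le_rfl ht.1 ht.2)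

lemma IsLipschitzCurve.lintegral_speed_ne_top {A B : ℝ} {γ : ℝ → M}
    (hγ : F.IsLipschitzCurve A B γ) :
    ∫⁻ t in Ioo A B, ENNReal.ofReal (F.speed A B γ t) ≠ ⊤ := by
  have hae := hγ.ae_restrict_Ioo le_rfl le_rfl
  obtain ⟨K, hK⟩ := hγ
  have h : ∫⁻ t in Ioo A B, ENNReal.ofReal (F.speed A B γ t) ≤ ∫⁻ _ in Ioo A B, (K : ℝ≥0∞) :=
    lintegral_mono_ae (by
      filter_upwards [hae] with t ht
      exact le_of_tendsto' (tendsto_gridQuotient le_rfl le_rfl ht.1 ht.2)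
        fun n ↦ gridQuotient_floor_le le_rfl le_rfl hK ht.1 n)
  refine ne_top_of_le_ne_top ?_ h
  rw [lintegral_const, Measure.restrict_apply_univ, Real.volume_Ioo]
  exact ENNReal.mul_ne_top ENNReal.coe_ne_top ENNReal.ofReal_ne_top

lemma IsLipschitzCurve.integrableOn_speed {A B : ℝ} {γ : ℝ → M}
    (hγ : F.IsLipschitzCurve A B γ) : IntegrableOn (F.speed A B γ) (Icc A B) := by
  rw [integrableOn_Icc_iff_integrableOn_Ioo]
  have hm : AEMeasurable (F.speed A B γ) (volume.restrict (Ioo A B)) :=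
    hγ.aemeasurable_ofReal_speed.ennreal_toReal.congr
      (.of_forall fun t ↦ ENNReal.toReal_ofReal (F.nonneg _))
  exact (lintegral_ofReal_ne_top_iff_integrable hm.aestronglyMeasurable
    (.of_forall fun t ↦ F.nonneg _)).1 hγ.lintegral_speed_ne_top

/-- By the triangle inequality every grid sum dominates the distance of the end points, and so does
their limit. -/
lemma IsLipschitzCurve.dist_le_lintegral {A B a b : ℝ} (hA : A ≤ a) (hab : a < b) (hB : b ≤ B)
    {γ : ℝ → M} (hγ : F.IsLipschitzCurve A B γ) :
    F.dist (γ a) (γ b) ≤ ∫⁻ t in Ioo a b, ENNReal.ofReal (F.speed A B γ t) := by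
  refine ge_of_tendsto' (hγ.tendsto_sum_dist hA hab hB) fun n ↦ ?_
  have h := F.dist_le_sum (fun i : ℕ ↦ γ (a + i * ((b - a) / (n + 1)))) (n + 1)
  have hb : a + (n + 1 : ℕ) * ((b - a) / (n + 1)) = b := by push_cast; field_simp; ring
  simp only [hb, Nat.cast_zero, zero_mul, add_zero] at h
  exact h

lemma IsLipschitzCurve.metricLength_eq {A B : ℝ} (hAB : A < B) {γ : ℝ → M}
    (hγ : F.IsLipschitzCurve A B γ) : F.metricLength A B γ = F.integralLength A B γ := by
  have hIoo : F.integralLength A B γ = ∫⁻ t in Ioo A B, ENNReal.ofReal (F.speed A B γ t) :=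
    (setLIntegral_congr Ioo_ae_eq_Icc).symm
  rw [hIoo]
  apply le_antisymm
  · refine iSup_le fun k ↦ iSup_le fun t ↦ iSup_le fun ht ↦ ?_
    have key : ∀ m ≤ k, ∑ i ∈ Finset.range m, F.dist (γ (t i)) (γ (t (i + 1)))
        ≤ ∫⁻ u in Ioo A (t m), ENNReal.ofReal (F.speed A B γ u) := by
      intro m
      induction m with
      | zero => simp
      | succ m ih =>
        intro hm
        have h1 := ht.mem_Icc (by omega : m ≤ k)
        have h2 := ht.mem_Icc hm
        have hlt := ht.2.2 m (by omega)
        rw [Finset.sum_range_succ, setLIntegral_Ioo_add h1.1 hlt.le]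
        exact add_le_add (ih (by omega)) (hγ.dist_le_lintegral h1.1 hlt h2.2)
    have := key k le_rfl
    rwa [ht.2.1] at this
  · refine le_of_tendsto' (hγ.tendsto_sum_dist le_rfl hAB le_rfl) fun n ↦ ?_
    have hpart : IsPartition A B (n + 1) (fun i : ℕ ↦ A + i * ((B - A) / (n + 1))) := by
      refine ⟨by simp, by push_cast; field_simp; ring, fun i _ ↦ ?_⟩
      have : 0 < (B - A) / ((n : ℝ) + 1) := div_pos (sub_pos.2 hAB) (by positivity)
      push_cast
      linarith
    exact le_iSup_of_le (n + 1) (le_iSup_of_le _ (le_iSup_of_le hpart le_rfl))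

end FinslerStructure

theorem theorem7p5
    {E : Type*} [NormedAddCommGroup E] [NormedSpace ℝ E] [FiniteDimensional ℝ E]
    {M : Type*} [TopologicalSpace M] [T2Space M] [ChartedSpace E M] [IsManifold 𝓘(ℝ, E) ∞ M]
    (F : FinslerStructure E M) (γ : ℝ → M) (hγ : F.IsLipschitzCurve 0 1 γ) :
    (∀ᵐ t ∂(volume.restrict (Icc (0 : ℝ) 1)),
      MDifferentiableWithinAt 𝓘(ℝ, ℝ) 𝓘(ℝ, E) γ (Icc 0 1) t) ∧
    IntegrableOn (F.speed 0 1 γ) (Icc 0 1) ∧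
    F.metricLength 0 1 γ = F.integralLength 0 1 γ :=
  ⟨hγ.ae_mdifferentiableWithinAt, hγ.integrableOn_speed, hγ.metricLength_eq one_pos⟩
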